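/- Conventions. A two-way transducer $\mathcal T=(\Sigma,\Gamma,Q,q_I,F,\Delta,\mu)$ has finite alphabets $\Sigma,\Gamma$, a finite set of states $Q=Q^+\uplus Q^-$ (forward and backward states), an initial state $q_I\in Q^+$, a set of final states $F\subseteq Q^+$, a transition relation $\Delta\subseteq Q\times(\Sigma\uplus\{\vdash,\dashv\})\times Q$ and an output function $\mu:\Delta\to\Gamma^*$; moreover, if $(p,\vdash,q)\in\Delta$ with $p\in Q^+$ then $p=q_I$, and if $(p,\dashv,q)\in\Delta$ with $q\in Q^+$ then $q\in F$. A configuration on ${\vdash}w{\dashv}$ is $u.p.u'$ with $p\in Q$ and $uu'={\vdash}w{\dashv}$. A state $p\in Q^+$ reads the first letter of $u'$, a state $p\in Q^-$ the last letter of $u$. After a transition $(p,a,q)\in\Delta$, where $a$ is the letter read, the head moves across $a$ (to the right if $p,q\in Q^+$, to the left if $p,q\in Q^-$) if $p,q$ have the same sign, and stays in place otherwise. An accepting run on $w\in\Sigma^*$ is a run from $q_I.{\vdash}w{\dashv}$ to ${\vdash}w{\dashv}.q$ for some $q\in F$; its output is the concatenation of the $\mu$-images of its transitions. The transduction $[\![\mathcal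 T]\!]\subseteq\Sigma^*\times\Gamma^*$ is the set of pairs $(w,v)$ such that some accepting run on $w$ has output $v$. The transducer is one-way if $Q^-=\emptyset$; deterministic if for all $(p,a)$ there is at most one $q$ with $(p,a,q)\in\Delta$; co-deterministic if for all $(q,a)$ there is at most one $p$ with $(p,a,q)\in\Delta$ and $F$ is a singleton; reversible if it is both deterministic and co-deterministic. A uniformization of a relation $R\subseteq\Sigma^*\times\Gamma^*$ is a partial function $f$ with $\operatorname{dom}f=\operatorname{dom}R=\{u : \exists v,\ (u,v)\in R\}$ and $(u,f(u))\in R$ for all $u\in\operatorname{dom}f$. Lemma. Let $\mathcal T$ be a one-way nondeterministic transducer with $n$ states. Then there is a reversible two-way transducer $\mathcal T'$, with the same input and output alphabets, such that $[\![\mathcal T']\!]$ is (the graph of) a uniformization of $[\![\mathcal T]\!]$ and $\mathcal T'$ has at most $144\,n^2\,2^{2n}$ states. -/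

import Mathlib

/-- The alphabet `σ` extended with two fresh symbols, the endmarkers `⊢` (`left`) and `⊣` (`right`). -/
inductive Marked (σ : Type*) where
  | left : Marked σ
  | letter : σ → Marked σ
  | right : Marked σ

/-- The word `⊢ u ⊣`. -/
def markWord {σ : Type*} (u : List σ) : List (Marked σ) :=
  Marked.left :: (u.map Marked.letter ++ [Marked.right])

/-- A two-way nondeterministic automaton over `σ` with set of states `Q`. The set of states is
partitioned into the forward states `fwd` and the backward states `fwdᶜ`. -/
structure TwoWayAutomaton (σ Q : Type*) where
  /-- the set of forward states -/
  fwd : Set Q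
  /-- the initial state -/
  init : Q
  /-- the set of final states -/
  acc : Set Q
  /-- the transition relation -/
  trans : Set (Q × Marked σ × Q)
  init_mem : init ∈ fwd
  acc_subset : acc ⊆ fwd
  /-- the initial state is the only forward state that may read the left endmarker -/
  left_convention : ∀ p q, p ∈ fwd → (p, Marked.left, q) ∈ trans → p = init
  /-- final states are the only forward states that may be entered by reading the right
  endmarker -/
  right_convention : ∀ p q, q ∈ fwd → (p, Marked.right, q) ∈ trans → q ∈ acc

/-- A configuration `u.p.u'`: the head stands between the words `u` and `u'`. -/
structure TwoWayConfig (σ Q : Type*) where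
  before : List (Marked σ)
  state : Q
  after : List (Marked σ)

namespace TwoWayAutomaton

variable {σ Q : Type*}

/-- `A.Step c t c'`: the configuration `c'` is a successor of `c` after the transition `t`.
A forward state reads the letter to the right of the head, a backward state the letter to its
left; the head moves across that letter exactly when the source and the target state have the
same sign. -/
inductive Step (A : TwoWayAutomaton σ Q) :
    TwoWayConfig σ Q → A.trans → TwoWayConfig σ Q → Prop
  | fwd_fwd (p q : Q) (a : Marked σ) (u v : List (Marked σ)) (h : (p, a, q) ∈ A.trans)
      (hp : p ∈ A.fwd) (hq : q ∈ A.fwd) :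
      Step A ⟨u, p, a :: v⟩ ⟨(p, a, q), h⟩ ⟨u ++ [a], q, v⟩
  | fwd_bwd (p q : Q) (a : Marked σ) (u v : List (Marked σ)) (h : (p, a, q) ∈ A.trans)
      (hp : p ∈ A.fwd) (hq : q ∉ A.fwd) :
      Step A ⟨u, p, a :: v⟩ ⟨(p, a, q), h⟩ ⟨u, q, a :: v⟩
  | bwd_fwd (p q : Q) (a : Marked σ) (u v : List (Marked σ)) (h : (p, a, q) ∈ A.trans)
      (hp : p ∉ A.fwd) (hq : q ∈ A.fwd) :
      Step A ⟨u ++ [a], p, v⟩ ⟨(p, a, q), h⟩ ⟨u ++ [a], q, v⟩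
  | bwd_bwd (p q : Q) (a : Marked σ) (u v : List (Marked σ)) (h : (p, a, q) ∈ A.trans)
      (hp : p ∉ A.fwd) (hq : q ∉ A.fwd) :
      Step A ⟨u ++ [a], p, v⟩ ⟨(p, a, q), h⟩ ⟨u, q, a :: v⟩

/-- `A.Run c ts c'`: there is a run from `c` to `c'` whose successive transitions are `ts`. -/
inductive Run (A : TwoWayAutomaton σ Q) :
    TwoWayConfig σ Q → List A.trans → TwoWayConfig σ Q → Prop
  | nil (c : TwoWayConfig σ Q) : Run A c [] c
  | cons {c c' c'' : TwoWayConfig σ Q} {t : A.trans} {ts : List A.trans} :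
      A.Step c t c' → Run A c' ts c'' → Run A c (t :: ts) c''

/-- `ts` is the list of transitions of an accepting run on `⊢ u ⊣`. -/
def AcceptingRun (A : TwoWayAutomaton σ Q) (u : List σ) (ts : List A.trans) : Prop :=
  ∃ q ∈ A.acc, A.Run ⟨[], A.init, markWord u⟩ ts ⟨markWord u, q, []⟩

/-- One-way automata: there is no backward state. -/
def IsOneWay (A : TwoWayAutomaton σ Q) : Prop :=
  A.fwdᶜ = ∅

def IsDeterministic (A : TwoWayAutomaton σ Q) : Prop :=
  ∀ p a q q', (p, a, q) ∈ A.trans → (p, a, q') ∈ A.trans → q = q'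

def IsCodeterministic (A : TwoWayAutomaton σ Q) : Prop :=
  (∀ p p' a q, (p, a, q) ∈ A.trans → (p', a, q) ∈ A.trans → p = p') ∧ ∃ qF, A.acc = {qF}

def IsReversible (A : TwoWayAutomaton σ Q) : Prop :=
  A.IsDeterministic ∧ A.IsCodeterministic

end TwoWayAutomaton

/-- A two-way nondeterministic transducer: a two-way automaton (its underlying automaton) with
an output word for each transition. -/
structure TwoWayTransducer (σ γ Q : Type*) extends TwoWayAutomaton σ Q where
  output : trans → List γ

/-- The transduction of `T`: all pairs `(u, v)` such that some accepting run on `⊢ u ⊣` has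
output `v`, the concatenation of the outputs of its transitions. -/
def TwoWayTransducer.transduction {σ γ Q : Type*} (T : TwoWayTransducer σ γ Q) :
    Set (List σ × List γ) :=
  {x | ∃ ts, T.AcceptingRun x.1 ts ∧ (ts.map T.output).flatten = x.2}

/-- The partial function `f` is a uniformization of the relation `R`. -/
def IsUniformization {α β : Type*} (f : α →. β) (R : Set (α × β)) : Prop :=
  f.Dom = {u | ∃ v, (u, v) ∈ R} ∧ ∀ u (hu : u ∈ f.Dom), (u, f.fn u hu) ∈ R

/-! Merge the final states into the initial state `r`: an input is in the domain when the marked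
word has a path from `r` to `r`. Such a path can be chosen canonically. At each position take the
set of states from which `r` can still be reached, computed from right to left; then, from left to
right, follow one fixed transition from the current state into the next set. Each computation is
deterministic in its own direction, but merges states; both have to be made reversible and then
composed.

Read on a word, a partial function on labels makes the pairs (position, label) a layered forest, and
the wanted computation is a branch ending in the only label of the last level that has a parent. The
outline of a tree can be followed reversibly. One token follows it on the left of the branch and one
on the right, at a common head position. When they surround a single label, this label is on the
branch (`eq_of_onSide`), so it is known from the state alone. By `exists_neutral_path` the tokens
surround the branch labels one after the other: the walk is deterministic in both time directions
and invariant under time reversal, so it neither meets its own mirror image nor enters a cycle, and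
finiteness forces it on.

The forest of sets has its root on the left, that of states on the right, so the second walk is run
backwards in time. In `compTrans` it moves only when the first walk enters a twin, and the first
walk is undone while the second one goes left; this preserves determinism and co-determinism. On the
domain the composition outputs the chosen run. Conversely, an accepting run keeps the first token in
the tree with root `{r}`, which puts the input in the domain (`exists_relPath_of_descends`). -/

/-- The strict order `<` as seen from the left (`s = false`) or from the right (`s = true`). -/
def Before {A : Type*} [LinearOrder A] (s : Bool) (c c' : A) : Prop :=
  if s then c' < c else c < c'

section Before

variable {A : Type*} [LinearOrder A]

theorem Before.not_iff {s : Bool} {c c' : A} : Before (!s) c c' ↔ Before s c' c := by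
  cases s <;> simp [Before]

theorem Before.irrefl {s : Bool} {c : A} : ¬ Before s c c := by
  cases s <;> simp [Before]

theorem Before.trans {s : Bool} {a b c : A} (h : Before s a b) (h' : Before s b c) :
    Before s a c := by
  cases s <;> simp only [Before, Bool.false_eq_true, if_true, if_false] at * <;> order

theorem Before.asymm {s : Bool} {a b : A} (h : Before s a b) : ¬ Before s b a :=
  fun h' => Before.irrefl (h.trans h')

theorem Before.trichotomy (s : Bool) (a b : A) : Before s a b ∨ a = b ∨ Before s b a := by
  cases s
  · simpa [Before] using lt_trichotomy a b
  · simpa [Before, eq_comm] using lt_trichotomy b a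

theorem Before.wellFounded [Finite A] (s : Bool) : WellFounded (Before (A := A) s) :=
  haveI : IsTrans A (Before s) := ⟨fun _ _ _ => Before.trans⟩
  haveI : Std.Irrefl (Before (A := A) s) := ⟨fun _ => Before.irrefl⟩
  Finite.wellFounded_of_trans_of_irrefl _

end Before

/-! ### Outlines of forests -/

/-- A token: a label together with a side (`false` is left, `true` is right). -/
abbrev Token (A : Type*) := A × Bool

/-- The partial function `g` maps labels (children) to labels (parents). `Link g p x p' x'` says
that the tokens `x` and `x'`, with places `p` and `p'` (`false` for parents, `true` for children),
are consecutive on the outline of the forest with edges `g`. -/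
inductive Link {A : Type*} [LinearOrder A] (g : A → Option A) :
    Bool → Token A → Bool → Token A → Prop
  | down (s : Bool) (S c : A) (h : g c = some S)
      (hc : ∀ d, g d = some S → ¬ Before s d c) : Link g false (S, s) true (c, s)
  | up (s : Bool) (S c : A) (h : g c = some S)
      (hc : ∀ d, g d = some S → ¬ Before s d c) : Link g true (c, s) false (S, s)
  | sibling (s : Bool) (S c c' : A) (h : g c = some S) (h' : g c' = some S)
      (hb : Before s c' c) (hc : ∀ d, g d = some S → Before s c' d → ¬ Before s d c) :
      Link g true (c, s) true (c', !s)
  | leaf (s : Bool) (S : A) (h : ∀ c, g c ≠ some S) : Link g false (S, s) false (S, !s)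

namespace Link

variable {A : Type*} [LinearOrder A] {g : A → Option A}

/-- The outline has no orientation: `down` and `up` are swapped, while `sibling` and `leaf` turn
into themselves with the sides exchanged. This is the source of reversibility. -/
theorem symm {p p' : Bool} {x x' : Token A} (h : Link g p x p' x') : Link g p' x' p x := by
  cases h with
  | down s S c h hc => exact .up s S c h hc
  | up s S c h hc => exact .down s S c h hc
  | sibling s S c c' h h' hb hc =>
    have := Link.sibling (!s) S c' c h' h (Before.not_iff.2 hb)
      fun d hd h1 h2 => hc d hd (Before.not_iff.1 h2) (Before.not_iff.1 h1)
    rwa [Bool.not_not] at this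
  | leaf s S h =>
    have := Link.leaf (!s) S h
    rwa [Bool.not_not] at this

theorem irrefl {p p' : Bool} {x : Token A} (h : Link g p x p' x) : p ≠ p' := by
  suffices H : ∀ y, Link g p x p' y → x = y → p ≠ p' from H x h rfl
  intro y h hy
  cases h <;> simp at hy ⊢

/-- The extremal child of a label is unique, and so is the nearest sibling on a given side. -/
theorem unique {p q r : Bool} {x y z : Token A} (h : Link g p x q y) (h' : Link g p x r z) :
    q = r ∧ y = z := by
  cases h with
  | down s S c h hc =>
    cases h' with
    | down _ _ d h' hd =>
      rcases Before.trichotomy s c d with h1 | h1 | h1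
      · exact absurd h1 (hd _ h)
      · simp [h1]
      · exact absurd h1 (hc _ h')
    | leaf _ _ h' => exact absurd h (h' _)
  | up s S c h hc =>
    cases h' with
    | up _ S' _ h' => rw [h] at h'; simpa using h'
    | sibling _ S' _ d h1 h2 h3 =>
      rw [h] at h1; cases h1
      exact absurd h3 (hc _ h2)
  | sibling s S c c' h h1 h2 h3 =>
    cases h' with
    | up _ S' _ h4 h5 =>
      rw [h] at h4; cases h4
      exact absurd h2 (h5 _ h1)
    | sibling _ S' _ d h4 h5 h6 h7 =>
      rw [h] at h4; cases h4
      rcases Before.trichotomy s c' d with h8 | h8 | h8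
      · exact absurd h6 (h3 _ h5 h8)
      · simp [h8]
      · exact absurd h2 (h7 _ h1 h8)
  | leaf s S h =>
    cases h' with
    | down _ _ d h' hd => exact absurd h' (h _)
    | leaf _ _ h' => simp

theorem exists_of_parent [Finite A] (x : Token A) : ∃ q y, Link g false x q y := by
  obtain ⟨S, s⟩ := x
  by_cases h : ∃ c, g c = some S
  · obtain ⟨c, hc, hm⟩ := (Before.wellFounded s).has_min {c | g c = some S} h
    exact ⟨_, _, .down s S c hc hm⟩
  · exact ⟨_, _, .leaf s S (by simpa using h)⟩

theorem exists_of_child [Finite A] (x : Token A) {S : A} (hS : g x.1 = some S) :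
    ∃ q y, Link g true x q y := by
  obtain ⟨c, s⟩ := x
  by_cases h : ∃ d, g d = some S ∧ Before s d c
  · obtain ⟨d, ⟨hd, hb⟩, hm⟩ :=
      (Before.wellFounded (!s)).has_min {d | g d = some S ∧ Before s d c} h
    refine ⟨_, _, .sibling s S c d hS hd hb fun e he h1 h2 => ?_⟩
    exact hm e ⟨he, h2⟩ (Before.not_iff.2 h1)
  · exact ⟨_, _, .up s S c hS fun d hd hb => h ⟨d, hd, hb⟩⟩

end Link

/-! ### Pairs of synchronized tokens -/

/-- Two tokens moving in a synchronized way. When both outlines cross the letter, or both turn,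
then both tokens move; otherwise only the token whose outline turns moves. -/
inductive PLink {A : Type*} [LinearOrder A] (g : A → Option A) :
    Bool → Token A × Token A → Bool → Token A × Token A → Prop
  | both (p p' : Bool) (x y x' y' : Token A) (hx : Link g p x p' x') (hy : Link g p y p' y') :
      PLink g p (x, y) p' (x', y')
  | left (p : Bool) (x y x' y' : Token A) (hx : Link g p x p x') (hy : Link g p y (!p) y') :
      PLink g p (x, y) p (x', y)
  | right (p : Bool) (x y x' y' : Token A) (hx : Link g p x (!p) x') (hy : Link g p y p y') :
      PLink g p (x, y) p (x, y')

namespace PLink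

variable {A : Type*} [LinearOrder A] {g : A → Option A}

/-- In a half-move the idle token stays in front of its crossing link, so the same rule undoes the
move. -/
theorem symm {p p' : Bool} {v v' : Token A × Token A} (h : PLink g p v p' v') :
    PLink g p' v' p v := by
  cases h with
  | both p' x y x' y' hx hy => exact .both _ _ _ _ _ _ hx.symm hy.symm
  | left x y x' y' hx hy => exact .left _ _ _ _ _ hx.symm hy
  | right x y x' y' hx hy => exact .right _ _ _ _ _ hx hy.symm

theorem irrefl {p p' : Bool} {v : Token A × Token A} (h : PLink g p v p' v) : p ≠ p' := by
  suffices H : ∀ w, PLink g p v p' w → v = w → p ≠ p' from H v h rfl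
  intro w h hw
  cases h with
  | both p' x y x' y' hx hy =>
    simp only [Prod.mk.injEq] at hw
    rw [hw.1] at hx
    exact hx.irrefl
  | left x y x' y' hx hy =>
    simp only [Prod.mk.injEq] at hw
    rw [hw.1] at hx
    exact hx.irrefl
  | right x y x' y' hx hy =>
    simp only [Prod.mk.injEq] at hw
    rw [hw.2] at hy
    exact hy.irrefl

theorem unique {p q r : Bool} {v w u : Token A × Token A} (h : PLink g p v q w)
    (h' : PLink g p v r u) : q = r ∧ w = u := by
  cases h <;> cases h' <;> rename_i h1 h2 _ _ h3 h4 <;>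
    have e1 := h1.unique h3 <;> have e2 := h2.unique h4 <;> clear h1 h2 h3 h4 <;> grind

theorem exists_of_exists {p q r : Bool} {x y x' y' : Token A} (hx : Link g p x q x')
    (hy : Link g p y r y') : ∃ p' w, PLink g p (x, y) p' w := by
  by_cases h : q = r
  · subst h
    exact ⟨_, _, .both _ _ _ _ _ _ hx hy⟩
  · by_cases hq : q = p
    · subst hq
      obtain rfl : r = !q := by revert h; cases q <;> cases r <;> simp
      exact ⟨_, _, .left _ _ _ _ _ hx hy⟩
    · obtain rfl : q = !p := by revert hq; cases q <;> cases p <;> simp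
      obtain rfl : r = p := by revert h; cases r <;> cases p <;> simp
      exact ⟨_, _, .right _ _ _ _ _ hx hy⟩

/-- The token on the left either stays in place or moves along a link. -/
theorem fst {p p' : Bool} {v v' : Token A × Token A} (h : PLink g p v p' v') :
    Link g p v.1 p' v'.1 ∨ (p = p' ∧ v.1 = v'.1) := by
  cases h with
  | both p' x y x' y' hx hy => exact .inl hx
  | left x y x' y' hx hy => exact .inl hx
  | right x y x' y' hx hy => exact .inr ⟨rfl, rfl⟩

/-- The token on the right either stays in place or moves along a link. -/
theorem snd {p p' : Bool} {v v' : Token A × Token A} (h : PLink g p v p' v') :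
    Link g p v.2 p' v'.2 ∨ (p = p' ∧ v.2 = v'.2) := by
  cases h with
  | both p' x y x' y' hx hy => exact .inl hy
  | left x y x' y' hx hy => exact .inr ⟨rfl, rfl⟩
  | right x y x' y' hx hy => exact .inl hy

end PLink

/-! ### Paths of reversible relations -/

section Paths

open Relation

variable {C : Type*} {R : C → C → Prop}

/-- `StepCount R n a b`: there is an `R`-path of length `n` from `a` to `b`. -/
def StepCount (R : C → C → Prop) : ℕ → C → C → Prop
  | 0, a, b => a = b
  | n + 1, a, b => ∃ c, R a c ∧ StepCount R n c b

theorem StepCount.tail {n : ℕ} : ∀ {a b c : C}, StepCount R n a b → R b c →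
    StepCount R (n + 1) a c := by
  induction n with
  | zero => rintro a b c rfl h; exact ⟨c, h, rfl⟩
  | succ n ih => rintro a b c ⟨d, hd, h⟩ h'; exact ⟨d, hd, ih h h'⟩

theorem StepCount.exists_tail {n : ℕ} : ∀ {a c : C}, StepCount R (n + 1) a c →
    ∃ b, StepCount R n a b ∧ R b c := by
  induction n with
  | zero => rintro a c ⟨d, hd, rfl⟩; exact ⟨a, rfl, hd⟩
  | succ n ih =>
    rintro a c ⟨d, hd, h⟩
    obtain ⟨b, hb, h'⟩ := ih h
    exact ⟨b, ⟨d, hd, hb⟩, h'⟩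

theorem exists_stepCount {a b : C} (h : ReflTransGen R a b) : ∃ n, StepCount R n a b := by
  induction h with
  | refl => exact ⟨0, rfl⟩
  | tail _ h ih => exact ⟨_, ih.choose_spec.tail h⟩

/-- In a deterministic relation that is invariant under a time-reversing involution, no path leads
from a point to its mirror image, as there is no point in which the path could turn around. -/
theorem not_reflTransGen_involution {bar : C → C} (det : ∀ a b c, R a b → R a c → b = c)
    (hbar : ∀ a b, R a b → R (bar b) (bar a)) (hinv : ∀ a, bar (bar a) = a)
    (hne : ∀ a, bar a ≠ a) (hturn : ∀ a, ¬ R a (bar a)) (a : C) :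
    ¬ ReflTransGen R a (bar a) := by
  intro h
  obtain ⟨n, hn⟩ := exists_stepCount h
  clear h
  induction n using Nat.strong_induction_on generalizing a with
  | _ n ih =>
    match n, hn with
    | 0, h => exact hne a h.symm
    | 1, ⟨c, hc, h⟩ => exact hturn a (h ▸ hc)
    -- Removing the first and the last step leaves a shorter path from `c` to its mirror image.
    | n + 2, ⟨c, hc, h⟩ =>
      obtain ⟨d, hd, hR⟩ := h.exists_tail
      have h1 := hbar _ _ hR
      rw [hinv] at h1
      have h2 : c = bar d := det _ _ _ hc h1
      have h3 : d = bar c := by rw [h2, hinv]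
      exact ih n (by omega) c (h3 ▸ hd)

/-- A path of a co-deterministic relation that starts in a point without predecessor does not
reach a cycle. -/
theorem not_transGen_self (codet : ∀ a b c, R a c → R b c → a = b) {a b : C}
    (ha : ∀ c, ¬ R c a) (h : ReflTransGen R a b) : ¬ TransGen R b b := by
  induction h with
  | refl =>
    intro h
    obtain ⟨c, -, hc⟩ := TransGen.tail'_iff.1 h
    exact ha c hc
  | @tail b c _ h ih =>
    intro h'
    obtain ⟨d, hd, hc⟩ := TransGen.tail'_iff.1 h'
    rw [codet _ _ _ hc h] at hd
    exact ih (TransGen.head' h hd)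

/-- If every point of a finite set that is reachable from `a` has a successor in the set, then `a`
lies on a cycle. -/
theorem transGen_self_of_finite (codet : ∀ a b c, R a c → R b c → a = b) {Z : Set C}
    (hZ : Z.Finite) {a : C} (ha : a ∈ Z) (hreach : ∀ c ∈ Z, ReflTransGen R a c)
    (hsucc : ∀ c ∈ Z, ∃ d ∈ Z, R c d) : TransGen R a a := by
  choose! f hf hR using hsucc
  have := hZ.to_subtype
  let F : Z → Z := fun c => ⟨f c, hf c c.2⟩
  -- An injective successor map on a finite set is surjective, so `a` has a predecessor in `Z`.
  have hF : Function.Injective F := by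
    intro c d h
    have h' : f c = f d := congrArg Subtype.val h
    exact Subtype.ext (codet _ _ _ (hR c c.2) (h' ▸ hR d d.2))
  obtain ⟨c, hc⟩ := (Finite.injective_iff_surjective.1 hF) ⟨a, ha⟩
  have h' : f c = a := congrArg Subtype.val hc
  exact TransGen.tail' (hreach c c.2) (h' ▸ hR c c.2)

end Paths

/-! ### The walk of two tokens around a branch -/

section Forest

open Relation

variable {A : Type*} [LinearOrder A]

/-- The pair of tokens on the two sides of the label `S`. -/
def twin (S : A) : Token A × Token A := ((S, false), (S, true))

/-- A layered forest of height `K`, where `g k` maps the labels of level `k + 1` to their parents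
in level `k`, with a branch `t` to the unique label of level `K` that has a parent. -/
structure IsBranch (K : ℕ) (g : ℕ → A → Option A) (t : ℕ → A) : Prop where
  edge : ∀ k < K, g k (t (k + 1)) = some (t k)
  leaf : ∀ k, k + 1 = K → ∀ c S, g k c = some S → c = t K

/-- `Beside g t s k S`: the label `S` of level `k` is a descendant of the root `t 0`, and it lies
strictly on the side `s` of the branch `t`. -/
def Beside (g : ℕ → A → Option A) (t : ℕ → A) (s : Bool) : ℕ → A → Prop
  | 0, _ => False
  | k + 1, c => ∃ S, g k c = some S ∧ (Beside g t s k S ∨ (S = t k ∧ Before s c (t (k + 1))))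

/-- The token `x` of level `k` lies on the side `s` of the branch `t`. -/
def OnSide (g : ℕ → A → Option A) (t : ℕ → A) (s : Bool) (k : ℕ) (x : Token A) : Prop :=
  Beside g t s k x.1 ∨ (x.1 = t k ∧ x.2 = s)

/-- The level of the lowest common ancestor of the label `S` of level `k` and the branch `t`. -/
def meetLevel (g : ℕ → A → Option A) (t : ℕ → A) : ℕ → A → ℕ
  | 0, _ => 0
  | k + 1, c => if c = t (k + 1) then k + 1 else (g k c).elim 0 (meetLevel g t k)

variable {K : ℕ} {g : ℕ → A → Option A} {t : ℕ → A}

theorem Beside.disjoint (ht : IsBranch K g t) {s : Bool} : ∀ {k : ℕ} {S : A}, k ≤ K →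
    Beside g t s k S → S ≠ t k ∧ ¬ Beside g t (!s) k S
  | 0, _, _, h => h.elim
  | k + 1, c, hk, ⟨S, hS, h⟩ => by
    have ih := fun h => Beside.disjoint ht (s := s) (k := k) (S := S) (by omega) h
    constructor
    · rintro rfl
      rw [ht.edge k (by omega)] at hS
      cases hS
      rcases h with h | ⟨-, h⟩
      · exact (ih h).1 rfl
      · exact Before.irrefl h
    · rintro ⟨S', hS', h'⟩
      rw [hS] at hS'
      cases hS'
      rcases h with h | ⟨e, h⟩ <;> rcases h' with h' | ⟨e', h'⟩
      · exact (ih h).2 h'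
      · exact (ih h).1 e'
      · have := (Beside.disjoint ht (k := k) (by omega) h').1
        exact this e
      · exact Before.asymm h (Before.not_iff.1 h')

/-- The two strict sides of the branch are disjoint from each other and from the branch, so tokens
guarding opposite sides can share only a branch label. The branch is thus detected locally. -/
theorem eq_of_onSide (ht : IsBranch K g t) {k : ℕ} (hk : k ≤ K) {S : A}
    (h : OnSide g t false k (S, false)) (h' : OnSide g t true k (S, true)) : S = t k := by
  rcases h with h | h
  · rcases h' with h' | h'
    · exact absurd h' (h.disjoint ht hk).2
    · exact h'.1
  · exact h.1

theorem onSide_zero {s : Bool} {x : Token A} (h : OnSide g t s 0 x) : x = (t 0, s) := by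
  rcases h with h | h
  · exact h.elim
  · exact Prod.ext h.1 h.2

theorem onSide_top (ht : IsBranch K g t) {s : Bool} {x : Token A} (h : OnSide g t s K x) :
    x = (t K, s) := by
  rcases h with h | h
  · match K, ht, h with
    | 0, _, h => exact h.elim
    | k + 1, ht, h =>
      have := (h.disjoint ht le_rfl).1
      obtain ⟨S, hS, -⟩ := h
      exact absurd (ht.leaf k rfl _ _ hS) this
  · exact Prod.ext h.1 h.2

theorem exists_parent_of_onSide (ht : IsBranch K g t) {s : Bool} {k : ℕ} (hk : k < K)
    {x : Token A} (h : OnSide g t s (k + 1) x) : ∃ S, g k x.1 = some S := by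
  rcases h with ⟨S, hS, -⟩ | h
  · exact ⟨S, hS⟩
  · exact ⟨_, h.1 ▸ ht.edge k hk⟩

/-- The outline does not cross the branch: siblings linked by it have no sibling in between, an
extremal child lies on the branch or beyond it on its own side, and branch labels above the last
level are not leaves, so no turn changes sides there. -/
theorem Link.onSide (ht : IsBranch K g t) {s : Bool} {k : ℕ} (hk : k < K) {p p' : Bool}
    {x x' : Token A} (h : Link (g k) p x p' x') (hx : OnSide g t s (k + p.toNat) x) :
    OnSide g t s (k + p'.toNat) x' := by
  have he := ht.edge k hk
  cases h with
  | down s' S c h hc =>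
    rcases hx with hx | ⟨rfl, rfl⟩
    · exact .inl ⟨S, h, .inl hx⟩
    · rcases Before.trichotomy s' c (t (k + 1)) with h1 | h1 | h1
      · exact .inl ⟨_, h, .inr ⟨rfl, h1⟩⟩
      · exact .inr ⟨h1, rfl⟩
      · exact absurd h1 (hc _ he)
  | up s' S c h hc =>
    rcases hx with ⟨S', hS', hx⟩ | ⟨rfl, rfl⟩
    · simp only at hS'
      rw [h] at hS'
      cases hS'
      rcases hx with hx | ⟨rfl, hx⟩
      · exact .inl hx
      · refine .inr ⟨rfl, ?_⟩
        by_contra hne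
        obtain rfl : s' = !s := by revert hne; cases s <;> cases s' <;> simp
        exact hc _ he (Before.not_iff.2 hx)
    · rw [Bool.toNat_true, he] at h
      cases h
      exact .inr ⟨rfl, rfl⟩
  | sibling s' S c c' h h' hb hc =>
    have key : ∀ S, g k c = some S → Beside g t s k S → OnSide g t s (k + 1) (c', !s') := by
      intro S' hS' hx
      rw [h] at hS'
      cases hS'
      exact .inl ⟨_, h', .inl hx⟩
    rcases hx with ⟨S', hS', hx⟩ | ⟨rfl, rfl⟩
    · simp only at hS'
      rw [h] at hS'
      cases hS'
      rcases hx with hx | ⟨rfl, hx⟩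
      · exact key _ h hx
      · have hx : Before s c (t (k + 1)) := hx
        rcases Before.trichotomy s c' (t (k + 1)) with h1 | h1 | h1
        · exact .inl ⟨_, h', .inr ⟨rfl, h1⟩⟩
        · refine .inr ⟨h1, ?_⟩
          subst h1
          by_contra hne
          obtain rfl : s' = s := by revert hne; cases s <;> cases s' <;> simp
          exact hb.asymm hx
        · by_cases hs : s' = s
          · subst hs
            exact absurd hb (hx.trans h1).asymm
          · obtain rfl : s' = !s := by revert hs; cases s <;> cases s' <;> simp
            exact absurd (Before.not_iff.2 hx) (hc _ he (Before.not_iff.2 h1))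
    · rw [Bool.toNat_true, he] at h
      cases h
      exact .inl ⟨_, h', .inr ⟨rfl, hb⟩⟩
  | leaf s' S h =>
    rcases hx with hx | ⟨rfl, rfl⟩
    · exact .inl hx
    · exact absurd he (h _)

theorem meetLevel_le : ∀ (k : ℕ) (S : A), meetLevel g t k S ≤ k
  | 0, _ => le_rfl
  | k + 1, c => by
    have := fun S => meetLevel_le k S
    rw [meetLevel]
    split
    · exact le_rfl
    · cases g k c with
      | none => simp
      | some S => exact (this S).trans (Nat.le_succ k)

theorem meetLevel_branch (k : ℕ) : meetLevel g t k (t k) = k := by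
  cases k <;> simp [meetLevel]

theorem eq_of_meetLevel {k : ℕ} {S : A} (h : meetLevel g t (k + 1) S = k + 1) :
    S = t (k + 1) := by
  by_contra hne
  rw [meetLevel, if_neg hne] at h
  cases hS : g k S with
  | none => rw [hS] at h; simp at h
  | some S' =>
    rw [hS] at h
    have := meetLevel_le (g := g) (t := t) k S'
    simp only [Option.elim] at h
    omega

theorem meetLevel_of_ne {k : ℕ} {c S : A} (hc : c ≠ t (k + 1)) (h : g k c = some S) :
    meetLevel g t (k + 1) c = meetLevel g t k S := by
  rw [meetLevel, if_neg hc, h, Option.elim]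

/-- The level of the meet only changes on links to and from the branch. -/
theorem Link.meetLevel (ht : IsBranch K g t) {k : ℕ} (hk : k < K) {p p' : Bool}
    {x x' : Token A} (h : Link (g k) p x p' x') :
    meetLevel g t (k + p.toNat) x.1 = meetLevel g t (k + p'.toNat) x'.1 ∨
      (p' = true ∧ x'.1 = t (k + 1) ∧ meetLevel g t (k + p.toNat) x.1 = k) ∨
      (p = true ∧ x.1 = t (k + 1) ∧ meetLevel g t (k + p'.toNat) x'.1 = k) := by
  have he := ht.edge k hk
  have hdown : ∀ c S, g k c = some S → _root_.meetLevel g t k S = _root_.meetLevel g t (k + 1) c ∨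
      (c = t (k + 1) ∧ _root_.meetLevel g t k S = k) := by
    intro c S h
    by_cases hc : c = t (k + 1)
    · subst hc
      rw [he] at h
      cases h
      exact .inr ⟨rfl, meetLevel_branch k⟩
    · exact .inl (meetLevel_of_ne hc h).symm
  cases h with
  | down s' S c h hc =>
    rcases hdown c S h with h | h
    · exact .inl h
    · exact .inr (.inl ⟨rfl, h⟩)
  | up s' S c h hc =>
    rcases hdown c S h with h | h
    · exact .inl h.symm
    · exact .inr (.inr ⟨rfl, h⟩)
  | sibling s' S c c' h h' hb hc =>
    by_cases h1 : c = t (k + 1)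
    · have h2 : c' ≠ t (k + 1) := by
        rintro rfl
        exact Before.irrefl (h1 ▸ hb)
      refine .inr (.inr ⟨rfl, h1, ?_⟩)
      subst h1
      rw [he] at h
      cases h
      exact (meetLevel_of_ne h2 h').trans (meetLevel_branch k)
    · by_cases h2 : c' = t (k + 1)
      · refine .inr (.inl ⟨rfl, h2, ?_⟩)
        subst h2
        rw [he] at h'
        cases h'
        exact (meetLevel_of_ne h1 h).trans (meetLevel_branch k)
      · exact .inl ((meetLevel_of_ne h1 h).trans (meetLevel_of_ne h2 h').symm)
  | leaf s' S h => exact .inl rfl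

/-- Configurations of the walk: a level, a pair of tokens and a direction (`true` is downwards). -/
abbrev WalkConfig (A : Type*) := ℕ × (Token A × Token A) × Bool

/-- The walk of a pair of tokens around a layered forest of height `K`. -/
def WalkStep (K : ℕ) (g : ℕ → A → Option A) (c c' : WalkConfig A) : Prop :=
  ∃ l < K, c.1 = l + (!c.2.2).toNat ∧ c'.1 = l + c'.2.2.toNat ∧
    PLink (g l) (!c.2.2) c.2.1 c'.2.2 c'.2.1

/-- The same place, with the opposite direction. -/
def WalkConfig.bar (c : WalkConfig A) : WalkConfig A := (c.1, c.2.1, !c.2.2)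

/-- The two tokens of the configuration lie on the two sides of the branch. -/
def OnSides (K : ℕ) (g : ℕ → A → Option A) (t : ℕ → A) (c : WalkConfig A) : Prop :=
  c.1 ≤ K ∧ OnSide g t false c.1 c.2.1.1 ∧ OnSide g t true c.1 c.2.1.2

/-- The level up to which the branch is separated from the rest by the two tokens. -/
def progress (g : ℕ → A → Option A) (t : ℕ → A) (c : WalkConfig A) : ℕ :=
  min (meetLevel g t c.1 c.2.1.1.1) (meetLevel g t c.1 c.2.1.2.1)

/-- The configuration of the walk when it passes the branch downwards at level `k`. -/
def branchConfig (t : ℕ → A) (k : ℕ) : WalkConfig A := (k, twin (t k), true)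

theorem WalkStep.bar {c c' : WalkConfig A} (h : WalkStep K g c c') : WalkStep K g c'.bar c.bar := by
  obtain ⟨l, hl, h1, h2, h3⟩ := h
  exact ⟨l, hl, by simpa [WalkConfig.bar] using h2, h1, by
    simpa [WalkConfig.bar] using h3.symm⟩

theorem WalkStep.det {c d e : WalkConfig A} (h : WalkStep K g c d) (h' : WalkStep K g c e) :
    d = e := by
  obtain ⟨l, -, h1, h2, h3⟩ := h
  obtain ⟨l', -, h1', h2', h3'⟩ := h'
  obtain rfl : l = l' := by omega
  obtain ⟨e1, e2⟩ := h3.unique h3'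
  exact Prod.ext (by rw [h2, h2', e1]) (Prod.ext e2 e1)

omit [LinearOrder A] in
theorem WalkConfig.bar_bar (c : WalkConfig A) : c.bar.bar = c := by
  simp [WalkConfig.bar]

/-- Time reversal turns determinism into co-determinism. -/
theorem WalkStep.codet {c d e : WalkConfig A} (h : WalkStep K g c e) (h' : WalkStep K g d e) :
    c = d := by
  rw [← c.bar_bar, h.bar.det h'.bar, d.bar_bar]

theorem WalkStep.not_bar (c : WalkConfig A) : ¬ WalkStep K g c c.bar := by
  rintro ⟨l, -, -, -, h⟩
  exact h.irrefl rfl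

theorem not_reflTransGen_bar (c : WalkConfig A) : ¬ ReflTransGen (WalkStep K g) c c.bar :=
  not_reflTransGen_involution (R := WalkStep K g) (bar := WalkConfig.bar)
    (fun _ _ _ => WalkStep.det) (fun _ _ => WalkStep.bar)
    WalkConfig.bar_bar (fun c h => by simpa [WalkConfig.bar] using congrArg (fun c => c.2.2) h)
    WalkStep.not_bar c

theorem WalkStep.onSides (ht : IsBranch K g t) {c c' : WalkConfig A} (h : WalkStep K g c c')
    (hc : OnSides K g t c) : OnSides K g t c' := by
  obtain ⟨k, v, D⟩ := c
  obtain ⟨k', v', D'⟩ := c'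
  obtain ⟨l, hl, h1, h2, h3⟩ := h
  simp only at h1 h2 h3
  subst h1 h2
  obtain ⟨hK, hx, hy⟩ := hc
  refine ⟨by cases D' <;> simp <;> omega, ?_, ?_⟩
  · rcases h3.fst with h | ⟨e, h⟩
    · exact h.onSide ht hl hx
    · rw [← e, ← h]; exact hx
  · rcases h3.snd with h | ⟨e, h⟩
    · exact h.onSide ht hl hy
    · rw [← e, ← h]; exact hy

/-- The walk gets stuck only at its two ends: at level 0 upwards and at level `K` downwards. In
between, finiteness provides the links; going up, the tokens have parents because they lie beside or
on the branch. -/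
theorem OnSides.exists_step [Finite A] (ht : IsBranch K g t) {c : WalkConfig A}
    (hc : OnSides K g t c) (h0 : c ≠ (branchConfig t 0).bar) (hK : c ≠ branchConfig t K) :
    ∃ c', WalkStep K g c c' := by
  obtain ⟨k, ⟨x, y⟩, D⟩ := c
  obtain ⟨hk, hx, hy⟩ := hc
  simp only at hk hx hy
  cases D with
  | true =>
    have hk : k < K := by
      refine lt_of_le_of_ne hk ?_
      rintro rfl
      exact hK (by rw [onSide_top ht hx, onSide_top ht hy]; rfl)
    obtain ⟨q, x', h1⟩ := Link.exists_of_parent (g := g k) x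
    obtain ⟨r, y', h2⟩ := Link.exists_of_parent (g := g k) y
    obtain ⟨p, w, h⟩ := PLink.exists_of_exists h1 h2
    exact ⟨(k + p.toNat, w, p), k, hk, rfl, rfl, h⟩
  | false =>
    match k, hk, hx, hy with
    | 0, hk, hx, hy =>
      exact absurd (by rw [onSide_zero hx, onSide_zero hy]; rfl) h0
    | k + 1, hk, hx, hy =>
      obtain ⟨S, hS⟩ := exists_parent_of_onSide ht hk hx
      obtain ⟨S', hS'⟩ := exists_parent_of_onSide ht hk hy
      obtain ⟨q, x', h1⟩ := Link.exists_of_child x hS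
      obtain ⟨r, y', h2⟩ := Link.exists_of_child y hS'
      obtain ⟨p, w, h⟩ := PLink.exists_of_exists h1 h2
      exact ⟨(k + p.toNat, w, p), k, hk, rfl, rfl, h⟩

theorem progress_branchConfig (k : ℕ) : progress g t (branchConfig t k) = k := by
  simp [progress, branchConfig, twin, meetLevel_branch]

theorem eq_twin (ht : IsBranch K g t) {k : ℕ} (hk : k ≤ K) {v : Token A × Token A}
    (hx : OnSide g t false k v.1) (hy : OnSide g t true k v.2) (h1 : v.1.1 = t k)
    (h2 : v.2.1 = t k) : v = twin (t k) := by
  obtain ⟨⟨S, s⟩, ⟨S', s'⟩⟩ := v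
  simp only at h1 h2
  subst h1 h2
  rcases hx with hx | ⟨-, rfl⟩
  · exact absurd rfl (hx.disjoint ht hk).1
  · rcases hy with hy | ⟨-, rfl⟩
    · exact absurd rfl (hy.disjoint ht hk).1
    · rfl

theorem eq_twin_of_meetLevel (ht : IsBranch K g t) {l : ℕ} {p : Bool} (hl : l + p.toNat ≤ K)
    {v : Token A × Token A} (hx : OnSide g t false (l + p.toNat) v.1)
    (hy : OnSide g t true (l + p.toNat) v.2)
    (h1 : meetLevel g t (l + p.toNat) v.1.1 = l + 1)
    (h2 : meetLevel g t (l + p.toNat) v.2.1 = l + 1) : p = true ∧ v = twin (t (l + 1)) := by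
  cases p with
  | false =>
    have := meetLevel_le (g := g) (t := t) l v.1.1
    simp only [Bool.toNat_false, Nat.add_zero] at h1
    omega
  | true => exact ⟨rfl, eq_twin ht hl hx hy (eq_of_meetLevel h1) (eq_of_meetLevel h2)⟩

/-- The progress only changes when the walk passes the branch. -/
theorem WalkStep.progress (ht : IsBranch K g t) {c c' : WalkConfig A} (h : WalkStep K g c c')
    (hc : OnSides K g t c) :
    progress g t c = progress g t c' ∨
      (∃ k, c' = branchConfig t (k + 1) ∧ progress g t c = k) ∨
      (∃ k, c = (branchConfig t (k + 1)).bar ∧ progress g t c' = k) := by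
  have hc' := h.onSides ht hc
  obtain ⟨k, v, D⟩ := c
  obtain ⟨k', v', D'⟩ := c'
  obtain ⟨l, hl, h1, h2, h3⟩ := h
  simp only at h1 h2 h3
  subst h1 h2
  obtain ⟨hK, hx, hy⟩ := hc
  obtain ⟨hK', hx', hy'⟩ := hc'
  simp only at hx hy hx' hy' hK hK'
  -- Each meet level can change only between `l` and `l + 1`. If the minimum changes, then both meet
  -- levels are `l + 1` before or after the step, which forces the branch twin there.
  have key : ∀ {x x' : Token A}, (Link (g l) (!D) x D' x' ∨ ((!D) = D' ∧ x = x')) →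
      let m := meetLevel g t (l + (!D).toNat) x.1
      let m' := meetLevel g t (l + D'.toNat) x'.1
      m ≤ l + 1 ∧ m' ≤ l + 1 ∧ (m = m' ∨ (m' = l + 1 ∧ m = l) ∨ (m = l + 1 ∧ m' = l)) := by
    intro x x' h
    refine ⟨(meetLevel_le _ _).trans (by cases D <;> simp),
      (meetLevel_le _ _).trans (by cases D' <;> simp), ?_⟩
    rcases h with h | ⟨e, e'⟩
    · rcases h.meetLevel ht hl with h | ⟨rfl, h, h'⟩ | ⟨hD, h, h'⟩
      · exact .inl h
      · exact .inr (.inl ⟨by rw [h]; exact meetLevel_branch _, h'⟩)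
      · exact .inr (.inr ⟨by rw [h, hD]; exact meetLevel_branch _, h'⟩)
    · rw [e, e']; exact .inl rfl
  obtain ⟨a1, a2, a3⟩ := key h3.fst
  obtain ⟨b1, b2, b3⟩ := key h3.snd
  simp only [_root_.progress]
  have e := eq_twin_of_meetLevel ht hK hx hy
  have e' := eq_twin_of_meetLevel ht hK' hx' hy'
  by_cases f : meetLevel g t (l + (!D).toNat) v.1.1 = l + 1 ∧
      meetLevel g t (l + (!D).toNat) v.2.1 = l + 1
  · obtain ⟨hD, hv⟩ := e f.1 f.2
    by_cases f' : meetLevel g t (l + D'.toNat) v'.1.1 = l + 1 ∧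
        meetLevel g t (l + D'.toNat) v'.2.1 = l + 1
    · obtain ⟨hD', hv'⟩ := e' f'.1 f'.2
      rw [hv, hv', hD, hD'] at h3
      exact absurd rfl h3.irrefl
    · right; right
      refine ⟨l, ?_, by omega⟩
      obtain rfl : D = false := by simpa using hD
      rw [hv]; rfl
  · by_cases f' : meetLevel g t (l + D'.toNat) v'.1.1 = l + 1 ∧
        meetLevel g t (l + D'.toNat) v'.2.1 = l + 1
    · obtain ⟨hD', hv'⟩ := e' f'.1 f'.2
      right; left
      refine ⟨l, ?_, by omega⟩
      rw [hv', hD']; rfl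
    · left
      omega

/-- Steps of the walk that do not enter a twin downwards. -/
def NeutralStep (K : ℕ) (g : ℕ → A → Option A) (c c' : WalkConfig A) : Prop :=
  WalkStep K g c c' ∧ ∀ S, c'.2 ≠ (twin S, true)

theorem walk_of_neutral {c c' : WalkConfig A} (h : ReflTransGen (NeutralStep K g) c c') :
    ReflTransGen (WalkStep K g) c c' := by
  induction h with
  | refl => exact .refl
  | tail _ h ih => exact ih.tail h.1

theorem branchConfig_onSides {k : ℕ} (hk : k ≤ K) : OnSides K g t (branchConfig t k) :=
  ⟨hk, .inr ⟨rfl, rfl⟩, .inr ⟨rfl, rfl⟩⟩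

theorem onSides_finite [Finite A] : {c | OnSides K g t c}.Finite := by
  refine Set.Finite.subset
    ((Set.finite_Iic K).prod (Set.finite_univ (α := (Token A × Token A) × Bool))) ?_
  rintro c ⟨hc, -⟩
  exact ⟨hc, trivial⟩

/-- Otherwise the set `Z` of configurations reached by neutral steps keeps progress `k`: a change
would enter the branch downwards, which is not neutral, or start from the mirror image of
`branchConfig t k`, which time reversal excludes. So `Z` avoids both dead ends and is finite, hence
`branchConfig t k` lies on a cycle. But it is reachable from `branchConfig t 0`, which has no
predecessor. -/
theorem exists_neutral_path_of_reachable [Finite A] (ht : IsBranch K g t) {k : ℕ} (hk : k < K)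
    (hreach : ReflTransGen (WalkStep K g) (branchConfig t 0) (branchConfig t k)) :
    ∃ c, ReflTransGen (NeutralStep K g) (branchConfig t k) c ∧
      WalkStep K g c (branchConfig t (k + 1)) := by
  by_contra! hcon
  set Z : Set (WalkConfig A) := {c | ReflTransGen (NeutralStep K g) (branchConfig t k) c} with hZ
  have hwalk : ∀ c ∈ Z, ReflTransGen (WalkStep K g) (branchConfig t k) c :=
    fun c hc => walk_of_neutral hc
  have hbar : ∀ c ∈ Z, c ≠ (branchConfig t k).bar := by
    rintro c hc rfl
    exact not_reflTransGen_bar _ (hwalk _ hc)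
  have hinv : ∀ c ∈ Z, OnSides K g t c ∧ progress g t c = k := by
    intro c hc
    induction hc with
    | refl => exact ⟨branchConfig_onSides hk.le, progress_branchConfig k⟩
    | @tail c d hc h ih =>
      refine ⟨h.1.onSides ht ih.1, ?_⟩
      rcases h.1.progress ht ih.1 with e | ⟨l, e, -⟩ | ⟨l, rfl, -⟩
      · rw [← e, ih.2]
      · exact absurd (by rw [e]; rfl) (h.2 (t (l + 1)))
      · have e : progress g t (branchConfig t (l + 1)) = k := ih.2
        rw [progress_branchConfig] at e
        exact absurd (by rw [e]) (hbar _ hc)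
  have hsucc : ∀ c ∈ Z, ∃ d ∈ Z, WalkStep K g c d := by
    intro c hc
    obtain ⟨hs, hp⟩ := hinv c hc
    obtain ⟨d, hd⟩ := hs.exists_step ht (by
      rintro rfl
      have e : progress g t (branchConfig t 0) = k := hp
      rw [progress_branchConfig] at e
      subst e
      exact hbar _ hc rfl) (by
      rintro rfl
      rw [progress_branchConfig] at hp
      omega)
    refine ⟨d, ?_, hd⟩
    by_cases hn : ∃ S, d.2 = (twin S, true)
    · obtain ⟨S, hS⟩ := hn
      have hds := hd.onSides ht hs
      have hS' : S = t d.1 := by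
        obtain ⟨h1, h2, h3⟩ := hds
        rw [hS] at h2 h3
        exact eq_of_onSide ht h1 h2 h3
      have hdb : d = branchConfig t d.1 := by
        refine Prod.ext rfl ?_
        rw [hS, hS']
        rfl
      rcases hd.progress ht hs with e | ⟨l, e, e'⟩ | ⟨l, rfl, -⟩
      -- A twin entered with unchanged progress is `branchConfig t k` again, which is in `Z` by the
      -- empty path.
      · rw [hdb, progress_branchConfig, hp] at e
        rw [hdb, ← e]
        exact ReflTransGen.refl
      · rw [hp] at e'
        subst e'
        exact absurd (e ▸ hd) (hcon c hc)
      · have e : progress g t (branchConfig t (l + 1)) = k := hp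
        rw [progress_branchConfig] at e
        exact absurd (by rw [e]) (hbar _ hc)
    · exact ReflTransGen.tail hc ⟨hd, fun S hS => hn ⟨S, hS⟩⟩
  have hcycle := transGen_self_of_finite (R := WalkStep K g) (fun _ _ _ => WalkStep.codet)
    (onSides_finite.subset fun c hc => (hinv c hc).1) (ReflTransGen.refl : branchConfig t k ∈ Z)
    hwalk hsucc
  refine not_transGen_self (R := WalkStep K g) (fun _ _ _ => WalkStep.codet) ?_ hreach hcycle
  -- A step that ends downwards ends at a positive level.
  rintro c ⟨l, -, -, h, -⟩
  simp [branchConfig] at h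

/-- From each branch configuration, neutral steps followed by one more step lead to the next
branch configuration. -/
theorem exists_neutral_path [Finite A] (ht : IsBranch K g t) {k : ℕ} (hk : k < K) :
    ∃ c, ReflTransGen (NeutralStep K g) (branchConfig t k) c ∧
      WalkStep K g c (branchConfig t (k + 1)) := by
  refine exists_neutral_path_of_reachable ht hk ?_
  induction k with
  | zero => exact .refl
  | succ k ih =>
    have hreach := ih (by omega)
    obtain ⟨c, hc, h⟩ := exists_neutral_path_of_reachable ht (by omega) hreach
    exact (hreach.trans (walk_of_neutral hc)).tail h

end Forest

/-! ### Two-way runs in terms of head positions -/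

section PosRun

variable {α γ S : Type*}

/-- A step of a two-way machine with transition relation `tr` on the word `W`, where a
configuration consists of a position in the word and a state; `sgn` tells the forward states. -/
def PosStep (sgn : S → Bool) (tr : α → S → S → List γ → Prop) (W : List α)
    (c : ℕ × S) (v : List γ) (c' : ℕ × S) : Prop :=
  ∃ l a, W[l]? = some a ∧ c.1 = l + (!sgn c.2).toNat ∧ c'.1 = l + (sgn c'.2).toNat ∧
    tr a c.2 c'.2 v

/-- Runs of a two-way machine, with their outputs. -/
inductive PosRun (sgn : S → Bool) (tr : α → S → S → List γ → Prop) (W : List α) :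
    ℕ × S → List γ → ℕ × S → Prop
  | nil (c : ℕ × S) : PosRun sgn tr W c [] c
  | cons {c c' c'' : ℕ × S} {v v' : List γ} : PosStep sgn tr W c v c' →
      PosRun sgn tr W c' v' c'' → PosRun sgn tr W c (v ++ v') c''

variable {sgn : S → Bool} {tr : α → S → S → List γ → Prop} {W : List α}

theorem PosRun.trans {c c' c'' : ℕ × S} {v v' : List γ} (h : PosRun sgn tr W c v c')
    (h' : PosRun sgn tr W c' v' c'') : PosRun sgn tr W c (v ++ v') c'' := by
  induction h with
  | nil => exact h'
  | cons hs _ ih => rw [List.append_assoc]; exact .cons hs (ih h')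

theorem PosStep.run {c c' : ℕ × S} {v : List γ} (h : PosStep sgn tr W c v c') :
    PosRun sgn tr W c v c' := by
  simpa using PosRun.cons h (.nil c')

theorem PosStep.det (det : ∀ a p q q' v v', tr a p q v → tr a p q' v' → q = q' ∧ v = v')
    {c d d' : ℕ × S} {v v' : List γ} (h : PosStep sgn tr W c v d)
    (h' : PosStep sgn tr W c v' d') : d = d' ∧ v = v' := by
  obtain ⟨l, a, ha, h1, h2, h3⟩ := h
  obtain ⟨l', a', ha', h1', h2', h3'⟩ := h'
  obtain rfl : l = l' := by omega
  rw [ha] at ha'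
  cases ha'
  obtain ⟨e, e'⟩ := det _ _ _ _ _ _ h3 h3'
  exact ⟨Prod.ext (by rw [h2, h2', e]) e, e'⟩

/-- As no step leaves `d`, neither run can properly extend the other. -/
theorem PosRun.det (det : ∀ a p q q' v v', tr a p q v → tr a p q' v' → q = q' ∧ v = v')
    {c d : ℕ × S} {v v' : List γ} (hd : ∀ v c', ¬ PosStep sgn tr W d v c')
    (h : PosRun sgn tr W c v d) (h' : PosRun sgn tr W c v' d) : v = v' := by
  induction h generalizing v' with
  | nil c =>
    cases h' with
    | nil => rfl
    | cons hs _ => exact absurd hs (hd _ _)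
  | cons hs _ ih =>
    cases h' with
    | nil => exact absurd hs (hd _ _)
    | cons hs' hr =>
      obtain ⟨rfl, rfl⟩ := hs.det det hs'
      rw [ih hd hr]

end PosRun

/-! ### Composition of the two walks -/

section Composite

open Relation

variable {α γ A B : Type*} [LinearOrder A] [LinearOrder B]

/-- The states of the walk of two tokens: the pair of tokens and the direction. -/
abbrev WalkState (A : Type*) := (Token A × Token A) × Bool

variable (G : α → A → Option A) (H : α × A → B → Option B) (out : α × A → B → List γ)

/-- The output of the second walk: when it leaves a twin to the right. -/
def Emits (b : α × A) (s : WalkState B) (v : List γ) : Prop :=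
  (∃ p, s = (twin p, true) ∧ v = out b p) ∨ ((∀ p, s ≠ (twin p, true)) ∧ v = [])

/-- The second walk takes part in a step of the first one if this enters a twin forwards. -/
def SecondWalk (a : α) (m : WalkState A) (s s' : WalkState B) (v : List γ) : Prop :=
  ((∀ S, m ≠ (twin S, true)) ∧ s' = s ∧ v = []) ∨
    ∃ S, m = (twin S, true) ∧ PLink (H (a, S)) s.2 s.1 (!s'.2) s'.1 ∧ Emits out (a, S) s v

/-- The composition of two walks: the first one around a forest of labels in `A` with its root on
the left; it passes each letter `a` with a label `S` to the second walk, which is around a forest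
of labels in `B` with its root on the right. When the second walk goes backwards, then the run of
the first one is reversed. -/
def compTrans (a : α) (p q : WalkState A × WalkState B) (v : List γ) : Prop :=
  ∃ m m' : WalkState A, PLink (G a) (!m.2) m.1 m'.2 m'.1 ∧ SecondWalk H out a m' p.2 q.2 v ∧
    p.1 = (if p.2.2 then m else m') ∧ q.1 = (if q.2.2 then m' else m)

/-- The forward states of the composition. -/
def compSign (p : WalkState A × WalkState B) : Bool := p.1.2 == p.2.2

variable {G H out}

omit [LinearOrder A] in
theorem twin_injective {S S' : A} (h : twin S = twin S') : S = S' :=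
  congrArg (fun v => v.1.1) h

omit [LinearOrder A] [LinearOrder B] in
theorem Emits.unique {b : α × A} {s : WalkState B} {v v' : List γ} (h : Emits out b s v)
    (h' : Emits out b s v') : v = v' := by
  rcases h with ⟨p, rfl, rfl⟩ | ⟨h, rfl⟩ <;> rcases h' with ⟨p', e, rfl⟩ | ⟨h', rfl⟩
  · rw [twin_injective (congrArg Prod.fst e)]
  · exact absurd rfl (h' _)
  · exact absurd e (h _)
  · rfl

omit [LinearOrder A] in
theorem SecondWalk.det {a : α} {m : WalkState A} {s s' s'' : WalkState B} {v v' : List γ}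
    (h : SecondWalk H out a m s s' v) (h' : SecondWalk H out a m s s'' v') :
    s' = s'' ∧ v = v' := by
  rcases h with ⟨h, rfl, rfl⟩ | ⟨S, rfl, h, hv⟩ <;>
    rcases h' with ⟨h', rfl, rfl⟩ | ⟨S', e, h', hv'⟩
  · exact ⟨rfl, rfl⟩
  · exact absurd e (h _)
  · exact absurd rfl (h' _)
  · obtain rfl := twin_injective (congrArg Prod.fst e)
    obtain ⟨e1, e2⟩ := h.unique h'
    exact ⟨Prod.ext e2 (by simpa using e1), hv.unique hv'⟩

omit [LinearOrder A] in
theorem SecondWalk.codet {a : α} {m : WalkState A} {s s' s'' : WalkState B} {v v' : List γ}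
    (h : SecondWalk H out a m s s'' v) (h' : SecondWalk H out a m s' s'' v') : s = s' := by
  rcases h with ⟨h, rfl, rfl⟩ | ⟨S, rfl, h, hv⟩ <;>
    rcases h' with ⟨h', rfl, rfl⟩ | ⟨S', e, h', hv'⟩
  · rfl
  · exact absurd e (h _)
  · exact absurd rfl (h' _)
  · obtain rfl := twin_injective (congrArg Prod.fst e)
    obtain ⟨e1, e2⟩ := h.symm.unique h'.symm
    exact Prod.ext e2 e1

theorem walk_det {a : α} {m m' m'' : WalkState A} (h : PLink (G a) (!m.2) m.1 m'.2 m'.1)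
    (h' : PLink (G a) (!m.2) m.1 m''.2 m''.1) : m' = m'' := by
  obtain ⟨e1, e2⟩ := h.unique h'
  exact Prod.ext e2 e1

theorem walk_codet {a : α} {m m' m'' : WalkState A} (h : PLink (G a) (!m.2) m.1 m''.2 m''.1)
    (h' : PLink (G a) (!m'.2) m'.1 m''.2 m''.1) : m = m' := by
  obtain ⟨e1, e2⟩ := h.symm.unique h'.symm
  exact Prod.ext e2 (by simpa using e1)

/-- The direction of the second walk tells which end of a step of the first walk is stored in the
state. Since that walk is deterministic in both directions, either end determines the step. -/
theorem compTrans_det (a : α) (p q q' : WalkState A × WalkState B) (v v' : List γ)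
    (h : compTrans G H out a p q v) (h' : compTrans G H out a p q' v') : q = q' ∧ v = v' := by
  obtain ⟨m, m', h1, h2, h3, h4⟩ := h
  obtain ⟨n, n', h1', h2', h3', h4'⟩ := h'
  obtain ⟨rfl, rfl⟩ : m = n ∧ m' = n' := by
    rw [h3] at h3'
    split at h3'
    · subst h3'
      exact ⟨rfl, walk_det h1 h1'⟩
    · subst h3'
      exact ⟨walk_codet h1 h1', rfl⟩
  obtain ⟨e, rfl⟩ := h2.det h2'
  exact ⟨Prod.ext (by rw [h4, h4', e]) e, rfl⟩

theorem compTrans_codet (a : α) (p p' q : WalkState A × WalkState B) (v v' : List γ)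
    (h : compTrans G H out a p q v) (h' : compTrans G H out a p' q v') : p = p' := by
  obtain ⟨m, m', h1, h2, h3, h4⟩ := h
  obtain ⟨n, n', h1', h2', h3', h4'⟩ := h'
  obtain ⟨rfl, rfl⟩ : m = n ∧ m' = n' := by
    rw [h4] at h4'
    split at h4'
    · subst h4'
      exact ⟨walk_codet h1 h1', rfl⟩
    · subst h4'
      exact ⟨rfl, walk_det h1 h1'⟩
  have e := h2.codet h2'
  exact Prod.ext (by rw [h3, h3', e]) e

/-- The forest of the first walk on the word `W`. -/
def firstForest (G : α → A → Option A) (W : List α) (l : ℕ) : A → Option A :=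
  (W[l]?).elim (fun _ => none) G

/-- The forest of the second walk on the word `W` with labels `S`. -/
def secondForest (H : α × A → B → Option B) (W : List α) (S : ℕ → A) (k : ℕ) : B → Option B :=
  (W[W.length - 1 - k]?).elim (fun _ => none) fun a => H (a, S (W.length - k))

omit [LinearOrder A] in
theorem firstForest_eq {W : List α} {l : ℕ} {a : α} (h : W[l]? = some a) :
    firstForest G W l = G a := by
  rw [firstForest, h, Option.elim]

variable {W : List α}

theorem NeutralStep.posStep {c c' : WalkConfig A}
    (h : NeutralStep W.length (firstForest G W) c c') {s : WalkState B} (hs : s.2 = true) :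
    PosStep compSign (compTrans G H out) W (c.1, (c.2, s)) [] (c'.1, (c'.2, s)) := by
  obtain ⟨⟨l, hl, h1, h2, h3⟩, hn⟩ := h
  have ha := List.getElem?_eq_getElem hl
  rw [firstForest_eq ha] at h3
  exact ⟨l, _, ha, by simpa [compSign, hs] using h1, by simpa [compSign, hs] using h2,
    c.2, c'.2, h3, .inl ⟨hn, rfl, rfl⟩, by simp [hs], by simp [hs]⟩

/-- While the second walk goes backwards, the stored end is the target, so the step is undone and
`compSign` inverts the sign. -/
theorem NeutralStep.posStep_reverse {c c' : WalkConfig A}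
    (h : NeutralStep W.length (firstForest G W) c c') {s : WalkState B} (hs : s.2 = false) :
    PosStep compSign (compTrans G H out) W (c'.1, (c'.2, s)) [] (c.1, (c.2, s)) := by
  obtain ⟨⟨l, hl, h1, h2, h3⟩, hn⟩ := h
  have ha := List.getElem?_eq_getElem hl
  rw [firstForest_eq ha] at h3
  exact ⟨l, _, ha, by simpa [compSign, hs] using h2, by simpa [compSign, hs] using h1,
    c.2, c'.2, h3, .inl ⟨hn, rfl, rfl⟩, by simp [hs], by simp [hs]⟩

theorem posRun_of_neutral {c c' : WalkConfig A}
    (h : ReflTransGen (NeutralStep W.length (firstForest G W)) c c') {s : WalkState B}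
    (hs : s.2 = true) :
    PosRun compSign (compTrans G H out) W (c.1, (c.2, s)) [] (c'.1, (c'.2, s)) := by
  induction h with
  | refl => exact .nil _
  | tail _ h ih => exact ih.trans (h.posStep hs).run

theorem posRun_of_neutral_reverse {c c' : WalkConfig A}
    (h : ReflTransGen (NeutralStep W.length (firstForest G W)) c c') {s : WalkState B}
    (hs : s.2 = false) :
    PosRun compSign (compTrans G H out) W (c'.1, (c'.2, s)) [] (c.1, (c.2, s)) := by
  induction h with
  | refl => exact .nil _
  | tail _ h ih => exact (h.posStep_reverse hs).run.trans ih

/-- The configuration of the composition where the first walk is at the branch `S`. -/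
def canonConfig (S : ℕ → A) (j : ℕ) (s : WalkState B) : ℕ × (WalkState A × WalkState B) :=
  (j, ((twin (S j), true), s))

/-- The composition simulates the steps of the second walk. -/
theorem posRun_of_secondWalk [Finite A] {S : ℕ → A}
    (hS : IsBranch W.length (firstForest G W) S) {j : ℕ} {a : α} (ha : W[j]? = some a)
    {s s' : WalkState B} {v : List γ} (h : PLink (H (a, S (j + 1))) s.2 s.1 (!s'.2) s'.1)
    (hv : Emits out (a, S (j + 1)) s v) :
    PosRun compSign (compTrans G H out) W (canonConfig S (j + (!s.2).toNat) s) v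
      (canonConfig S (j + s'.2.toNat) s') := by
  obtain ⟨hj, -⟩ := List.getElem?_eq_some_iff.1 ha
  obtain ⟨c, hc, hstep⟩ := exists_neutral_path hS hj
  obtain ⟨l, hl, h1, h2, h3⟩ := hstep
  obtain rfl : l = j := by simpa [branchConfig, eq_comm] using h2
  rw [firstForest_eq ha] at h3
  -- The synchronizing step of the first walk joins `c` and `branchConfig S (l + 1)`. The direction
  -- of `s` decides at which end the machine arrives, that of `s'` at which end it leaves.
  let d : WalkConfig A := if s.2 then c else branchConfig S (l + 1)
  let d' : WalkConfig A := if s'.2 then branchConfig S (l + 1) else c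
  have r1 : PosRun compSign (compTrans G H out) W (canonConfig S (l + (!s.2).toNat) s) []
      (d.1, (d.2, s)) := by
    by_cases hs : s.2
    · have := posRun_of_neutral (H := H) (out := out) hc hs
      simpa [d, hs, canonConfig, branchConfig] using this
    · simp only [d, hs]
      exact .nil _
  have r2 : PosStep compSign (compTrans G H out) W (d.1, (d.2, s)) v (d'.1, (d'.2, s')) := by
    refine ⟨l, a, ha, ?_, ?_, c.2, (branchConfig S (l + 1)).2, h3, .inr ⟨_, rfl, h, hv⟩, ?_, ?_⟩
    · cases hs : s.2 <;> simp [d, compSign, hs, h1, branchConfig]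
    · cases hs : s'.2 <;> simp [d', compSign, hs, h1, branchConfig]
    · cases hs : s.2 <;> simp [d, hs]
    · cases hs : s'.2 <;> simp [d', hs]
  have r3 : PosRun compSign (compTrans G H out) W (d'.1, (d'.2, s')) []
      (canonConfig S (l + s'.2.toNat) s') := by
    cases hs : s'.2
    · have := posRun_of_neutral_reverse (H := H) (out := out) hc hs
      simpa [d', hs, canonConfig, branchConfig] using this
    · simp only [d', hs]
      exact .nil _
  simpa using r1.trans (r2.run.trans r3)

/-- A path in a labelled transition system, with its output. -/
inductive RelPath (Rv : α → B → B → List γ → Prop) : List α → B → List γ → B → Prop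
  | nil (p : B) : RelPath Rv [] p [] p
  | cons {a : α} {W : List α} {p q r : B} {v v' : List γ} : Rv a p q v → RelPath Rv W q v' r →
      RelPath Rv (a :: W) p (v ++ v') r

/-- Levels of the second forest count from the right end and its walk is run backwards in time, so
by `PLink.symm` a step from `c` to `c'` becomes a run from `c'` to `c`. -/
theorem posRun_of_walkStep [Finite A] {S : ℕ → A}
    (hS : IsBranch W.length (firstForest G W) S) {c c' : WalkConfig B} {l : ℕ}
    (hl : l < W.length) (h1 : c.1 = l + (!c.2.2).toNat) (h2 : c'.1 = l + c'.2.2.toNat)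
    (h3 : PLink (secondForest H W S l) (!c.2.2) c.2.1 c'.2.2 c'.2.1) {v : List γ}
    (hv : Emits out (W[W.length - 1 - l], S (W.length - l)) c'.2 v) :
    PosRun compSign (compTrans G H out) W (canonConfig S (W.length - c'.1) c'.2) v
      (canonConfig S (W.length - c.1) c.2) := by
  have hj : W.length - 1 - l < W.length := by omega
  have ha := List.getElem?_eq_getElem hj
  have e : W.length - l = W.length - 1 - l + 1 := by omega
  rw [secondForest, ha, Option.elim, e] at h3
  rw [e] at hv
  have := posRun_of_secondWalk hS ha h3.symm hv
  convert this using 2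
  · rw [h2]; cases c'.2.2 <;> simp <;> omega
  · rw [h1]; cases c.2.2 <;> simp <;> omega

/-- The run of the composition along two branches. -/
theorem exists_posRun [Finite A] [Finite B] {S : ℕ → A} {p : ℕ → B}
    (hS : IsBranch W.length (firstForest G W) S)
    (hp : IsBranch W.length (secondForest H W S) fun k => p (W.length - k))
    {Rv : α → B → B → List γ → Prop}
    (hR : ∀ j (hj : j < W.length), Rv W[j] (p j) (p (j + 1)) (out (W[j], S (j + 1)) (p j)))
    {k : ℕ} (hk : k ≤ W.length) :
    ∃ v, PosRun compSign (compTrans G H out) W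
        (canonConfig S (W.length - k) (twin (p (W.length - k)), true)) v
        (canonConfig S W.length (twin (p W.length), true)) ∧
      RelPath Rv (W.drop (W.length - k)) (p (W.length - k)) v (p W.length) := by
  induction k with
  | zero =>
    refine ⟨[], .nil _, ?_⟩
    simpa using RelPath.nil _
  | succ k ih =>
    obtain ⟨v, hv, hpath⟩ := ih (by omega)
    obtain ⟨c, hc, l, hl, h1, h2, h3⟩ := exists_neutral_path hp (k := k) (by omega)
    obtain rfl : l = k := by simpa [branchConfig, eq_comm] using h2
    have hj : W.length - (l + 1) < W.length := by omega
    have e : W.length - l = W.length - (l + 1) + 1 := by omega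
    refine ⟨out (W[W.length - (l + 1)], S (W.length - (l + 1) + 1)) (p (W.length - (l + 1))) ++ v,
      ?_, ?_⟩
    -- In reversed time the last step of the walk comes first: it leaves the twin and emits its
    -- output, and the neutral steps after it are silent.
    · have r1 := posRun_of_walkStep (out := out) hS hl h1 h2 h3 (.inl ⟨_, rfl, rfl⟩)
      have r2 : PosRun compSign (compTrans G H out) W (canonConfig S (W.length - c.1) c.2) []
          (canonConfig S (W.length - l) (twin (p (W.length - l)), true)) := by
        clear h1 h3 r1
        induction hc with
        | refl => exact .nil _
        | tail _ h ih =>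
          obtain ⟨⟨m, hm, h1, h2, h3⟩, hn⟩ := h
          have := posRun_of_walkStep (out := out) hS hm h1 h2 h3 (.inr ⟨hn, rfl⟩)
          exact this.trans ih
      have := r1.trans (r2.trans hv)
      simp only [branchConfig, List.nil_append] at this
      have h0 : W[W.length - 1 - l] = W[W.length - (l + 1)] := by congr 1; omega
      rwa [h0, e] at this
    · rw [List.drop_eq_getElem_cons hj]
      refine .cons (hR _ hj) ?_
      rwa [← e]

/-- The label `S` at position `i` is a descendant of the root `r`. -/
def Descends (G : α → A → Option A) (W : List α) (r : A) : ℕ → A → Prop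
  | 0, S => S = r
  | i + 1, c => ∃ a S, W[i]? = some a ∧ G a c = some S ∧ Descends G W r i S

theorem Link.descends {r : A} {l : ℕ} {a : α} (ha : W[l]? = some a) {p p' : Bool}
    {x x' : Token A} (h : Link (G a) p x p' x') (hx : Descends G W r (l + p.toNat) x.1) :
    Descends G W r (l + p'.toNat) x'.1 := by
  cases h with
  | down s S c h hc => exact ⟨a, S, ha, h, hx⟩
  | up s S c h hc =>
    obtain ⟨a', S', ha', hS', hx⟩ := hx
    rw [ha] at ha'
    cases ha'
    rw [h] at hS'
    cases hS'
    exact hx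
  | sibling s S c c' h h' hb hc =>
    obtain ⟨a', S', ha', hS', hx⟩ := hx
    rw [ha] at ha'
    cases ha'
    rw [h] at hS'
    cases hS'
    exact ⟨a, S, ha, h', hx⟩
  | leaf s S h => exact hx

theorem PLink.descends {r : A} {l : ℕ} {a : α} (ha : W[l]? = some a) {p p' : Bool}
    {v v' : Token A × Token A} (h : PLink (G a) p v p' v')
    (hx : Descends G W r (l + p.toNat) v.1.1) : Descends G W r (l + p'.toNat) v'.1.1 := by
  rcases h.fst with h' | ⟨rfl, h'⟩
  · exact h'.descends ha hx
  · rwa [← h']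

/-- Forwards or backwards, the first token follows the outline of one tree. This needs no branch, so
it also applies to inputs outside the domain. -/
theorem PosStep.descends {r : A} {c c' : ℕ × (WalkState A × WalkState B)} {v : List γ}
    (h : PosStep compSign (compTrans G H out) W c v c')
    (hc : Descends G W r c.1 c.2.1.1.1.1) : Descends G W r c'.1 c'.2.1.1.1.1 := by
  obtain ⟨l, a, ha, h1, h2, m, m', hm, -, h3, h4⟩ := h
  have k1 : Descends G W r (l + (!m.2).toNat) m.1.1.1 ∧ Descends G W r (l + m'.2.toNat) m'.1.1.1 := by
    rw [h1] at hc
    cases hs : c.2.2.2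
    · rw [hs] at h3
      simp only [compSign, hs, h3] at hc
      have hc : Descends G W r (l + m'.2.toNat) m'.1.1.1 := by simpa using hc
      exact ⟨hm.symm.descends ha hc, hc⟩
    · rw [hs] at h3
      simp only [compSign, hs, h3] at hc
      have hc : Descends G W r (l + (!m.2).toNat) m.1.1.1 := by simpa using hc
      exact ⟨hc, hm.descends ha hc⟩
  rw [h2]
  cases hs : c'.2.2.2
  · rw [hs] at h4
    simpa [compSign, hs, h4] using k1.1
  · rw [hs] at h4
    simpa [compSign, hs, h4] using k1.2

theorem PosRun.descends {r : A} {c c' : ℕ × (WalkState A × WalkState B)} {v : List γ}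
    (h : PosRun compSign (compTrans G H out) W c v c')
    (hc : Descends G W r c.1 c.2.1.1.1.1) : Descends G W r c'.1 c'.2.1.1.1.1 := by
  induction h with
  | nil => exact hc
  | cons hs _ ih => exact ih (hs.descends hc)

end Composite

/-! ### From transition relations to two-way transducers -/

section Machine

variable {σ γ P : Type*}

theorem markWord_getElem?_left {u : List σ} {l : ℕ} (h : (markWord u)[l]? = some .left) :
    l = 0 := by
  cases l with
  | zero => rfl
  | succ l =>
    rw [markWord, List.getElem?_cons_succ] at h
    have := List.mem_of_getElem? h
    simp at this

theorem markWord_getElem?_right {u : List σ} {l : ℕ} (h : (markWord u)[l]? = some .right) :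
    l + 1 = (markWord u).length := by
  cases l with
  | zero => simp [markWord] at h
  | succ l =>
    rw [markWord, List.getElem?_cons_succ] at h
    obtain ⟨hl, -⟩ := List.getElem?_eq_some_iff.1 h
    simp only [List.length_append, List.length_map, List.length_singleton] at hl
    simp only [markWord, List.length_cons, List.length_append, List.length_map, List.length_nil]
    by_contra hne
    rw [List.getElem?_append_left (by simp; omega)] at h
    have := List.mem_of_getElem? h
    simp at this

/-- The two-way transducer with the transition relation `tr`, without the transitions that are
excluded by the conventions on the endmarkers. The only final state is the initial one. -/
noncomputable def machine (sgn : P → Bool) (i₀ : P) (hi : sgn i₀ = true)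
    (tr : Marked σ → P → P → List γ → Prop) : TwoWayTransducer σ γ P where
  fwd := {p | sgn p = true}
  init := i₀
  acc := {i₀}
  trans := {t | (∃ v, tr t.2.1 t.1 t.2.2 v) ∧
    (t.2.1 = .left → sgn t.1 = true → t.1 = i₀) ∧
    (t.2.1 = .right → sgn t.2.2 = true → t.2.2 = i₀)}
  init_mem := hi
  acc_subset := by rintro _ rfl; exact hi
  left_convention := fun _ _ hp h => h.2.1 rfl hp
  right_convention := fun _ _ hq h => h.2.2 rfl hq
  output := fun t => t.2.1.choose

variable {sgn : P → Bool} {i₀ : P} {hi : sgn i₀ = true} {tr : Marked σ → P → P → List γ → Prop}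

theorem machine_isReversible
    (det : ∀ a p q q' v v', tr a p q v → tr a p q' v' → q = q' ∧ v = v')
    (codet : ∀ a p p' q v v', tr a p q v → tr a p' q v' → p = p') :
    (machine sgn i₀ hi tr).IsReversible := by
  refine ⟨?_, ?_, i₀, rfl⟩
  · rintro p a q q' ⟨⟨v, h⟩, -⟩ ⟨⟨v', h'⟩, -⟩
    exact (det _ _ _ _ _ _ h h').1
  · rintro p p' a q ⟨⟨v, h⟩, -⟩ ⟨⟨v', h'⟩, -⟩
    exact codet _ _ _ _ _ _ h h'

theorem posStep_of_step {W : List (Marked σ)} {c c' : TwoWayConfig σ P}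
    {t : (machine sgn i₀ hi tr).trans} (h : (machine sgn i₀ hi tr).Step c t c')
    (hc : c.before ++ c.after = W) :
    PosStep sgn tr W (c.before.length, c.state) ((machine sgn i₀ hi tr).output t)
      (c'.before.length, c'.state) ∧ c'.before ++ c'.after = W := by
  subst hc
  have hout := t.2.1.choose_spec
  cases h with
  | fwd_fwd p q a u v h hp hq =>
    have hp : sgn p = true := hp
    have hq : sgn q = true := hq
    exact ⟨⟨u.length, a, by simp, by simp [hp], by simp [hq], hout⟩, by simp⟩
  | fwd_bwd p q a u v h hp hq =>
    have hp : sgn p = true := hp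
    have hq : sgn q = false := Bool.not_eq_true _ ▸ hq
    exact ⟨⟨u.length, a, by simp, by simp [hp], by simp [hq], hout⟩, by simp⟩
  | bwd_fwd p q a u v h hp hq =>
    have hp : sgn p = false := Bool.not_eq_true _ ▸ hp
    have hq : sgn q = true := hq
    exact ⟨⟨u.length, a, by simp, by simp [hp], by simp [hq], hout⟩, by simp⟩
  | bwd_bwd p q a u v h hp hq =>
    have hp : sgn p = false := Bool.not_eq_true _ ▸ hp
    have hq : sgn q = false := Bool.not_eq_true _ ▸ hq
    exact ⟨⟨u.length, a, by simp, by simp [hp], by simp [hq], hout⟩, by simp⟩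

theorem posRun_of_run {W : List (Marked σ)} {c c' : TwoWayConfig σ P}
    {ts : List (machine sgn i₀ hi tr).trans} (h : (machine sgn i₀ hi tr).Run c ts c')
    (hc : c.before ++ c.after = W) :
    PosRun sgn tr W (c.before.length, c.state)
      (ts.map (machine sgn i₀ hi tr).output).flatten (c'.before.length, c'.state) := by
  induction h with
  | nil => exact .nil _
  | cons hs _ ih =>
    obtain ⟨h1, h2⟩ := posStep_of_step hs hc
    simpa using PosRun.cons h1 (ih h2)

theorem exists_step_of_posStep
    (det : ∀ a p q q' v v', tr a p q v → tr a p q' v' → q = q' ∧ v = v')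
    {W : List (Marked σ)} {l : ℕ} {a : Marked σ} (ha : W[l]? = some a) {p q : P} {v : List γ}
    (h : tr a p q v) (hleft : a = .left → sgn p = true → p = i₀)
    (hright : a = .right → sgn q = true → q = i₀) :
    ∃ t : (machine sgn i₀ hi tr).trans, (machine sgn i₀ hi tr).output t = v ∧
      (machine sgn i₀ hi tr).Step
        ⟨W.take (l + (!sgn p).toNat), p, W.drop (l + (!sgn p).toNat)⟩ t
        ⟨W.take (l + (sgn q).toNat), q, W.drop (l + (sgn q).toNat)⟩ := by
  have ht : (p, a, q) ∈ (machine sgn i₀ hi tr).trans := ⟨⟨v, h⟩, hleft, hright⟩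
  refine ⟨⟨(p, a, q), ht⟩, (det _ _ _ _ _ _ (Exists.choose_spec ht.1) h).2, ?_⟩
  obtain ⟨hl, rfl⟩ := List.getElem?_eq_some_iff.1 ha
  have e1 : W.take (l + 1) = W.take l ++ [W[l]] := by simp
  have e2 : W.drop l = W[l] :: W.drop (l + 1) := List.drop_eq_getElem_cons hl
  cases hp : sgn p <;> cases hq : sgn q <;>
    simp only [Bool.not_true, Bool.not_false, Bool.toNat_true, Bool.toNat_false, Nat.add_zero]
  · rw [e1, e2]
    exact .bwd_bwd _ _ _ _ _ ht (by simp [machine, hp]) (by simp [machine, hq])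
  · rw [e1]
    exact .bwd_fwd _ _ _ _ _ ht (by simp [machine, hp]) hq
  · rw [e2]
    exact .fwd_bwd _ _ _ _ _ ht hp (by simp [machine, hq])
  · rw [e1, e2]
    exact .fwd_fwd _ _ _ _ _ ht hp hq

/-- The transitions removed for the endmarkers are not needed: position 0 is re-entered only in
backward states and the position behind the last letter is entered only in forward states. No step
leaves such a configuration, so it can only be the end of the run. -/
theorem exists_run_of_posRun
    (det : ∀ a p q q' v v', tr a p q v → tr a p q' v' → q = q' ∧ v = v') {u : List σ}
    {c c' : ℕ × P} {v : List γ} (h : PosRun sgn tr (markWord u) c v c')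
    (hc : c.1 = 0 → c.2 = i₀) (hc' : c' = ((markWord u).length, i₀)) :
    ∃ ts, (machine sgn i₀ hi tr).Run ⟨(markWord u).take c.1, c.2, (markWord u).drop c.1⟩ ts
        ⟨markWord u, i₀, []⟩ ∧ (ts.map (machine sgn i₀ hi tr).output).flatten = v := by
  induction h with
  | nil c =>
    subst hc'
    refine ⟨[], ?_, rfl⟩
    simpa using TwoWayAutomaton.Run.nil _
  | @cons c d e v v' hs hr ih =>
    obtain ⟨l, a, ha, h1, h2, h3⟩ := hs
    obtain ⟨hl, -⟩ := List.getElem?_eq_some_iff.1 ha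
    have hd : d.1 = 0 → d.2 = i₀ := by
      intro h0
      have hq : sgn d.2 = false := by
        cases hq : sgn d.2 with
        | false => rfl
        | true => rw [hq, h0] at h2; simp at h2
      cases hr with
      | nil => rw [hc']
      | cons hs _ =>
        obtain ⟨l', a', -, h1', -⟩ := hs
        rw [hq, h0] at h1'
        simp at h1'
    obtain ⟨ts, hrun, hout⟩ := ih hd hc'
    obtain ⟨t, ht, hstep⟩ := exists_step_of_posStep (hi := hi) det ha h3 (by
        intro e hp
        rw [e] at ha
        apply hc
        rw [h1, hp, markWord_getElem?_left ha]
        rfl) (by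
        intro e hq
        rw [e] at ha
        have hlen := markWord_getElem?_right ha
        cases hr with
        | nil => rw [hc']
        | cons hs _ =>
          obtain ⟨l', a', ha', h1', -⟩ := hs
          obtain ⟨hl', -⟩ := List.getElem?_eq_some_iff.1 ha'
          rw [h2, hq] at h1'
          simp at h1'
          omega)
    rw [← h1, ← h2] at hstep
    exact ⟨t :: ts, .cons hstep hrun, by simp [ht, hout]⟩

theorem mem_transduction_machine
    (det : ∀ a p q q' v v', tr a p q v → tr a p q' v' → q = q' ∧ v = v') {u : List σ}
    {v : List γ} : (u, v) ∈ (machine sgn i₀ hi tr).transduction ↔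
      PosRun sgn tr (markWord u) (0, i₀) v ((markWord u).length, i₀) := by
  constructor
  · rintro ⟨ts, ⟨q, hq, hrun⟩, rfl⟩
    rw [show q = i₀ from hq] at hrun
    exact posRun_of_run hrun rfl
  · intro h
    obtain ⟨ts, hrun, hout⟩ := exists_run_of_posRun (hi := hi) det h (fun _ => rfl) rfl
    exact ⟨ts, ⟨i₀, rfl, hrun⟩, hout⟩

theorem transduction_machine_unique
    (det : ∀ a p q q' v v', tr a p q v → tr a p q' v' → q = q' ∧ v = v') {u : List σ}
    {v v' : List γ} (h : (u, v) ∈ (machine sgn i₀ hi tr).transduction)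
    (h' : (u, v') ∈ (machine sgn i₀ hi tr).transduction) : v = v' := by
  rw [mem_transduction_machine det] at h h'
  refine PosRun.det det ?_ h h'
  rintro w c ⟨l, a, ha, h1, -⟩
  obtain ⟨hl, -⟩ := List.getElem?_eq_some_iff.1 ha
  simp only [hi] at h1
  simp at h1
  omega

end Machine

/-! ### The canonical choice of a path -/

section Uniformization

variable {σ γ A B : Type*}

theorem RelPath.append {α : Type*} {Rv : α → B → B → List γ → Prop} {W W' : List α} {p q r : B}
    {v v' : List γ} (h : RelPath Rv W p v q) (h' : RelPath Rv W' q v' r) :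
    RelPath Rv (W ++ W') p (v ++ v') r := by
  induction h with
  | nil => exact h'
  | cons hs _ ih =>
    rw [List.append_assoc]
    exact .cons hs (ih h')

variable (e : A ≃ Set B) (r : B) (Rv : Marked σ → B → B → List γ → Prop)

open Classical in
/-- The predecessors of a set of states, as a partial function on the codes of sets. At the right
endmarker, only the code of `{r}` has predecessors. -/
noncomputable def predCode (a : Marked σ) (c : A) : Option A :=
  if a = .right ∧ c ≠ e.symm {r} then none
  else some (e.symm {p | ∃ q ∈ e c, ∃ v, Rv a p q v})

open Classical in
/-- A transition from the state `p` to a state in the set coded by `b.2`. -/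
noncomputable def chosenTrans (b : Marked σ × A) (p : B) : Option (B × List γ) :=
  if h : ∃ x : B × List γ, x.1 ∈ e b.2 ∧ Rv b.1 p x.1 x.2 then some h.choose else none

/-- The target of the chosen transition. -/
noncomputable def chosenNext (b : Marked σ × A) (p : B) : Option B :=
  (chosenTrans e Rv b p).map Prod.fst

/-- The output of the chosen transition. -/
noncomputable def chosenOutput (b : Marked σ × A) (p : B) : List γ :=
  (chosenTrans e Rv b p).elim [] Prod.snd

/-- The code of the set of states from which `r` can be reached on the `l`-th suffix of `W`. -/
noncomputable def suffixCode (W : List (Marked σ)) (l : ℕ) : A :=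
  e.symm {p | ∃ v, RelPath Rv (W.drop l) p v r}

/-- The states of the chosen path. -/
noncomputable def chosenPath (W : List (Marked σ)) : ℕ → B
  | 0 => r
  | j + 1 => ((W[j]?).bind fun a =>
      chosenNext e Rv (a, suffixCode e r Rv W (j + 1)) (chosenPath W j)).getD r

variable {e r Rv}

theorem exists_chosenTrans {b : Marked σ × A} {p q : B} {v : List γ} (hq : q ∈ e b.2)
    (h : Rv b.1 p q v) : ∃ x, chosenTrans e Rv b p = some x := by
  have H : ∃ x : B × List γ, x.1 ∈ e b.2 ∧ Rv b.1 p x.1 x.2 := ⟨(q, v), hq, h⟩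
  exact ⟨H.choose, dif_pos H⟩

theorem chosenTrans_spec {b : Marked σ × A} {p : B} {x : B × List γ}
    (h : chosenTrans e Rv b p = some x) : x.1 ∈ e b.2 ∧ Rv b.1 p x.1 x.2 := by
  rw [chosenTrans] at h
  split at h
  · rename_i H
    cases h
    exact H.choose_spec
  · cases h

theorem suffixCode_length (W : List (Marked σ)) :
    suffixCode e r Rv W W.length = e.symm {r} := by
  rw [suffixCode, List.drop_length]
  congr 1
  ext p
  constructor
  · rintro ⟨v, h⟩
    cases h
    rfl
  · rintro rfl
    exact ⟨[], .nil _⟩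

/-- The states that reach `r` on a suffix are the predecessors of those that do so on the next
shorter one. The exception in `predCode` at `⊣` provides the leaf condition. -/
theorem isBranch_suffixCode (u : List σ) :
    IsBranch (markWord u).length (firstForest (predCode e r Rv) (markWord u))
      (suffixCode e r Rv (markWord u)) := by
  constructor
  · intro k hk
    have ha := List.getElem?_eq_getElem hk
    rw [firstForest_eq ha, predCode, if_neg]
    · rw [suffixCode, suffixCode, List.drop_eq_getElem_cons hk, Equiv.apply_symm_apply]
      congr 2
      ext p
      constructor
      · rintro ⟨q, ⟨v', h'⟩, v, h⟩
        exact ⟨_, .cons h h'⟩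
      · rintro ⟨v, h⟩
        cases h with
        | cons h h' => exact ⟨_, ⟨_, h'⟩, _, h⟩
    · rintro ⟨h, h'⟩
      rw [h] at ha
      rw [markWord_getElem?_right ha] at h'
      exact h' (suffixCode_length _)
  · intro k hk c S h
    have hk' : k < (markWord u).length := by omega
    have ha : (markWord u)[k]? = some .right := by
      simp only [markWord, List.length_cons, List.length_append, List.length_map,
        List.length_nil] at hk
      obtain rfl : k = u.length + 1 := by omega
      simp [markWord]
    rw [firstForest_eq ha, predCode] at h
    split at h
    · cases h
    · rename_i hn
      rw [suffixCode_length]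
      by_contra hne
      exact hn ⟨rfl, hne⟩

/-- The path stays among the states that can still reach `r`, so a transition to choose always
exists and the default values are not used. -/
theorem chosenPath_spec {W : List (Marked σ)} (hW : ∃ v, RelPath Rv W r v r) {j : ℕ}
    (hj : j ≤ W.length) : chosenPath e r Rv W j ∈ e (suffixCode e r Rv W j) ∧
      ∀ i (hi : i < j), chosenTrans e Rv (W[i], suffixCode e r Rv W (i + 1))
        (chosenPath e r Rv W i) = some (chosenPath e r Rv W (i + 1),
          chosenOutput e Rv (W[i], suffixCode e r Rv W (i + 1)) (chosenPath e r Rv W i)) := by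
  induction j with
  | zero => exact ⟨by simpa [suffixCode, chosenPath] using hW, fun i hi => absurd hi (by omega)⟩
  | succ j ih =>
    obtain ⟨h1, h2⟩ := ih (by omega)
    have hj : j < W.length := by omega
    have ha := List.getElem?_eq_getElem hj
    rw [suffixCode, Equiv.apply_symm_apply, List.drop_eq_getElem_cons hj] at h1
    obtain ⟨v, h⟩ := h1
    generalize hp : chosenPath e r Rv W j = p at h
    cases h with
    | @cons _ _ _ q _ v v' h h' =>
      obtain ⟨x, hx⟩ := exists_chosenTrans (e := e) (Rv := Rv)
        (b := (W[j], suffixCode e r Rv W (j + 1))) (q := q)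
        (by rw [suffixCode, Equiv.apply_symm_apply]; exact ⟨_, h'⟩) h
      have hnext : chosenPath e r Rv W (j + 1) = x.1 := by
        rw [chosenPath, ha, hp]
        simp [chosenNext, hx]
      constructor
      · rw [hnext]
        exact (chosenTrans_spec hx).1
      · intro i hi
        rcases Nat.lt_succ_iff_lt_or_eq.1 hi with hi | rfl
        · exact h2 i hi
        · rw [hp, hnext, chosenOutput, hx]
          rfl

/-- The last level of this forest is at `⊢`, where by `hleft` only `r` has a transition; this is its
leaf condition. -/
theorem isBranch_chosenPath (hleft : ∀ p q v, Rv .left p q v → p = r) {u : List σ}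
    (hu : ∃ v, RelPath Rv (markWord u) r v r) :
    IsBranch (markWord u).length
      (secondForest (chosenNext e Rv) (markWord u) (suffixCode e r Rv (markWord u)))
      fun k => chosenPath e r Rv (markWord u) ((markWord u).length - k) := by
  constructor
  · intro k hk
    have hj : (markWord u).length - 1 - k < (markWord u).length := by omega
    have ha := List.getElem?_eq_getElem hj
    have h := (chosenPath_spec (e := e) hu le_rfl).2 _ hj
    have e1 : (markWord u).length - 1 - k + 1 = (markWord u).length - k := by omega
    have e2 : (markWord u).length - (k + 1) = (markWord u).length - 1 - k := by omega
    rw [secondForest, ha, Option.elim]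
    rw [e1] at h
    simp only [e2, chosenNext, h, Option.map_some]
  · intro k hk c S h
    have ha : (markWord u)[(markWord u).length - 1 - k]? = some .left := by
      rw [show (markWord u).length - 1 - k = 0 by omega]
      rfl
    rw [secondForest, ha, Option.elim, chosenNext, Option.map_eq_some_iff] at h
    obtain ⟨x, hx, -⟩ := h
    rw [hleft _ _ _ (chosenTrans_spec hx).2]
    simp [chosenPath]

/-- Taking predecessors `i` times from `c` yields `{r}`, so `r` has a path into the set coded by
`c`. -/
theorem exists_relPath_of_descends {W : List (Marked σ)} {i : ℕ} {c : A}
    (h : Descends (predCode e r Rv) W (e.symm {r}) i c) :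
    ∃ q ∈ e c, ∃ v, RelPath Rv (W.take i) r v q := by
  induction i generalizing c with
  | zero =>
    rw [show c = e.symm {r} from h]
    exact ⟨r, by simp, [], .nil _⟩
  | succ i ih =>
    obtain ⟨a, S, ha, hS, h⟩ := h
    obtain ⟨p, hp, v, hv⟩ := ih h
    rw [predCode] at hS
    split at hS
    · cases hS
    · cases hS
      rw [Equiv.apply_symm_apply] at hp
      obtain ⟨q, hq, v', hv'⟩ := hp
      obtain ⟨hi, rfl⟩ := List.getElem?_eq_some_iff.1 ha
      refine ⟨q, hq, v ++ (v' ++ []), ?_⟩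
      rw [← List.take_concat_get' _ _ hi]
      exact hv.append (.cons hv' (.nil _))

/-- A reversible transducer that uniformizes the relation given by the paths from `r` to `r`. -/
theorem exists_reversible [LinearOrder A] [LinearOrder B] [Finite A] [Finite B] (e : A ≃ Set B)
    {r : B} (hleft : ∀ p q v, Rv .left p q v → p = r) :
    ∃ T' : TwoWayTransducer σ γ (WalkState A × WalkState B), T'.IsReversible ∧
      (∀ u v v', (u, v) ∈ T'.transduction → (u, v') ∈ T'.transduction → v = v') ∧
      (∀ u v, (u, v) ∈ T'.transduction → ∃ v', RelPath Rv (markWord u) r v' r) ∧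
      ∀ u, (∃ v, RelPath Rv (markWord u) r v r) →
        ∃ v, (u, v) ∈ T'.transduction ∧ RelPath Rv (markWord u) r v r := by
  have det := compTrans_det (G := predCode e r Rv) (H := chosenNext e Rv)
    (out := chosenOutput e Rv)
  have hi : compSign ((twin (e.symm {r}), true), (twin r, true)) = true := by simp [compSign]
  refine ⟨machine compSign ((twin (e.symm {r}), true), (twin r, true)) hi
    (compTrans (predCode e r Rv) (chosenNext e Rv) (chosenOutput e Rv)),
    machine_isReversible det compTrans_codet, fun u v v' => transduction_machine_unique det, ?_, ?_⟩
  · intro u v h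
    rw [mem_transduction_machine det] at h
    -- The token starts and ends on the code of `{r}`, so the path obtained leads from `r` to `r`.
    obtain ⟨q, hq, v', hv'⟩ := exists_relPath_of_descends (h.descends (r := e.symm {r}) rfl)
    have hq : q ∈ e (e.symm {r}) := hq
    rw [Equiv.apply_symm_apply] at hq
    cases hq
    exact ⟨v', by simpa using hv'⟩
  · intro u hu
    have hspec := chosenPath_spec (e := e) hu le_rfl
    have hend : chosenPath e r Rv (markWord u) (markWord u).length = r := by
      have := hspec.1
      rw [suffixCode_length, Equiv.apply_symm_apply] at this
      exact this
    -- Only `r` can read `⊢`, so the first label is `{r}` like the last one, and one state serves as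
    -- initial and as final state.
    have hstart : suffixCode e r Rv (markWord u) 0 = e.symm {r} := by
      rw [suffixCode]
      congr 1
      ext p
      constructor
      · rintro ⟨v, h⟩
        cases h with
        | cons h _ => exact hleft _ _ _ h
      · rintro rfl
        exact hu
    obtain ⟨v, hv, hpath⟩ := exists_posRun (Rv := Rv) (out := chosenOutput e Rv)
      (isBranch_suffixCode (e := e) (Rv := Rv) u)
      (isBranch_chosenPath hleft hu) (fun j hj => (chosenTrans_spec (hspec.2 j hj)).2)
      (k := (markWord u).length) le_rfl
    rw [hend, Nat.sub_self] at hpath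
    refine ⟨v, ?_, hpath⟩
    rw [mem_transduction_machine det]
    rw [hend, Nat.sub_self, canonConfig, canonConfig, suffixCode_length, hstart] at hv
    exact hv

end Uniformization

/-! ### One-way transducers as paths from `r` to `r` -/

section OneWay

variable {σ γ Q B : Type*} (T : TwoWayTransducer σ γ Q) (f : B ≃ Q)

/-- The transitions of `T`, with their outputs, where the final states are replaced by the initial
one. -/
def loopTrans (a : Marked σ) (p q : B) (v : List γ) : Prop :=
  (a ≠ .right ∧ ∃ h : (f p, a, f q) ∈ T.trans, T.output ⟨_, h⟩ = v) ∨
    (a = .right ∧ q = f.symm T.init ∧ ∃ q' ∈ T.acc, ∃ h : (f p, a, q') ∈ T.trans,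
      T.output ⟨_, h⟩ = v)

variable {T f}

theorem mem_fwd (hT : T.IsOneWay) (q : Q) : q ∈ T.fwd := by
  by_contra h
  have : q ∈ T.fwdᶜ := h
  rw [show T.fwdᶜ = ∅ from hT] at this
  exact this

theorem loopTrans_left (hT : T.IsOneWay) (p q : B) (v : List γ) (h : loopTrans T f .left p q v) :
    p = f.symm T.init := by
  rcases h with ⟨-, h, -⟩ | ⟨h, -⟩
  · rw [← T.left_convention _ _ (mem_fwd hT _) h, Equiv.symm_apply_apply]
  · cases h

/-- As `⊣` occurs only at the end, exactly the last transition has its target redirected to the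
initial state. -/
theorem relPath_of_run (hT : T.IsOneWay) {c c' : TwoWayConfig σ Q} {ts : List T.trans}
    (h : T.Run c ts c') (hc' : c'.after = []) (hacc : c'.state ∈ T.acc) {w : List (Marked σ)}
    (hc : c.after = w ++ [.right]) (hw : Marked.right ∉ w) :
    RelPath (loopTrans T f) c.after (f.symm c.state) (ts.map T.output).flatten
      (f.symm T.init) := by
  induction h generalizing w with
  | nil c => rw [hc'] at hc; simp at hc
  | cons hs hr ih =>
    cases hs with
    | fwd_fwd p q a u v h hp hq =>
      cases w with
      | nil =>
        simp only [List.nil_append, List.cons.injEq] at hc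
        obtain ⟨rfl, rfl⟩ := hc
        have hnil : ∀ {d ts d'}, T.Run d ts d' → d.after = [] → ts = [] ∧ d' = d := by
          intro d ts d' h hd
          cases h with
          | nil => exact ⟨rfl, rfl⟩
          | cons hs _ =>
            cases hs with
            | fwd_fwd => cases hd
            | fwd_bwd => cases hd
            | bwd_fwd p q a u v h hp hq => exact absurd (mem_fwd hT _) hp
            | bwd_bwd p q a u v h hp hq => exact absurd (mem_fwd hT _) hp
        obtain ⟨rfl, rfl⟩ := hnil hr rfl
        refine .cons (.inr ⟨rfl, rfl, q, hacc, ?_, ?_⟩) (.nil _)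
        · simpa using h
        · congr 2; simp
      | cons b w =>
        simp only [List.cons_append, List.cons.injEq] at hc
        obtain ⟨rfl, rfl⟩ := hc
        simp only [List.mem_cons, not_or] at hw
        refine .cons (.inl ⟨Ne.symm hw.1, ?_, ?_⟩) (ih hc' hacc rfl hw.2)
        · simpa using h
        · congr 2; simp
    | fwd_bwd p q a u v h hp hq => exact absurd (mem_fwd hT _) hq
    | bwd_fwd p q a u v h hp hq => exact absurd (mem_fwd hT _) hp
    | bwd_bwd p q a u v h hp hq => exact absurd (mem_fwd hT _) hp

theorem exists_run_of_relPath (hT : T.IsOneWay) {w u : List (Marked σ)} (hw : Marked.right ∉ w)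
    {p r : B} {v : List γ} (h : RelPath (loopTrans T f) (w ++ [.right]) p v r) :
    ∃ ts, ∃ q ∈ T.acc, T.Run ⟨u, f p, w ++ [.right]⟩ ts ⟨u ++ (w ++ [.right]), q, []⟩ ∧
      (ts.map T.output).flatten = v := by
  induction w generalizing u p v with
  | nil =>
    cases h with
    | cons h h' =>
      cases h'
      rcases h with ⟨h, -⟩ | ⟨-, -, q, hq, h, rfl⟩
      · exact absurd rfl h
      · exact ⟨[⟨_, h⟩], q, hq, .cons (.fwd_fwd _ _ _ _ _ h (mem_fwd hT _) (mem_fwd hT _)) (.nil _),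
          by simp⟩
  | cons a w ih =>
    simp only [List.mem_cons, not_or] at hw
    cases h with
    | cons h h' =>
      rcases h with ⟨-, h, rfl⟩ | ⟨h, -⟩
      · obtain ⟨ts, q, hq, hr, rfl⟩ := ih (u := u ++ [a]) hw.2 h'
        refine ⟨⟨_, h⟩ :: ts, q, hq,
          .cons (.fwd_fwd _ _ _ _ _ h (mem_fwd hT _) (mem_fwd hT _)) ?_, by simp⟩
        simpa using hr
      · exact absurd h.symm hw.1

theorem mem_transduction_iff_relPath (hT : T.IsOneWay) {u : List σ} {v : List γ} :
    (u, v) ∈ T.transduction ↔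
      RelPath (loopTrans T f) (markWord u) (f.symm T.init) v (f.symm T.init) := by
  have e : markWord u = (.left :: u.map .letter) ++ [.right] := rfl
  have hw : Marked.right ∉ (.left :: u.map .letter : List (Marked σ)) := by simp
  constructor
  · rintro ⟨ts, ⟨q, hq, hrun⟩, rfl⟩
    exact relPath_of_run hT hrun rfl hq e hw
  · intro h
    rw [e] at h
    obtain ⟨ts, q, hq, hrun, rfl⟩ := exists_run_of_relPath (u := []) hT hw h
    rw [Equiv.apply_symm_apply] at hrun
    exact ⟨ts, ⟨q, hq, hrun⟩, rfl⟩

end OneWay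

/-! ### Assembly and count of states -/

theorem mainTheorem5 {σ γ Q : Type*} [Finite σ] [Finite γ] [Fintype Q]
    (T : TwoWayTransducer σ γ Q) (hT : T.IsOneWay) (n : ℕ) (hn : Fintype.card Q = n) :
    ∃ (Q' : Type) (_ : Fintype Q') (T' : TwoWayTransducer σ γ Q'),
      T'.IsReversible ∧
      (∃ f : List σ →. List γ, T'.transduction = f.graph ∧
        IsUniformization f T.transduction) ∧
      Fintype.card Q' ≤ 144 * n ^ 2 * 2 ^ (2 * n) := by
  classical
  -- Copies in `Fin` supply the linear orders for the outlines and put the new states in `Type`.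
  let f : Fin n ≃ Q := (Fintype.equivFinOfCardEq hn).symm
  let e : Fin (2 ^ n) ≃ Set (Fin n) := (Fintype.equivFinOfCardEq (by simp)).symm
  obtain ⟨T', hrev, huniq, hdom, hmem⟩ := exists_reversible (Rv := loopTrans T f) e
    (loopTrans_left hT)
  let g : List σ →. List γ := fun u => ⟨∃ v, (u, v) ∈ T'.transduction, fun h => h.choose⟩
  have hg : ∀ u v, v ∈ g u ↔ (u, v) ∈ T'.transduction := by
    intro u v
    constructor
    · rintro ⟨h, rfl⟩
      exact Exists.choose_spec (p := fun v => (u, v) ∈ T'.transduction) h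
    · intro h
      have H : ∃ v, (u, v) ∈ T'.transduction := ⟨v, h⟩
      exact ⟨H, huniq _ _ _ H.choose_spec h⟩
  refine ⟨WalkState (Fin (2 ^ n)) × WalkState (Fin n), inferInstance, T', hrev,
    ⟨g, ?_, ?_, ?_⟩, ?_⟩
  · ext ⟨u, v⟩
    exact (hg u v).symm
  · ext u
    constructor
    · rintro ⟨v, h⟩
      obtain ⟨v', h'⟩ := hdom _ _ h
      exact ⟨v', (mem_transduction_iff_relPath hT).2 h'⟩
    · rintro ⟨v, h⟩
      obtain ⟨v', h', -⟩ := hmem u ⟨v, (mem_transduction_iff_relPath hT).1 h⟩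
      exact ⟨v', h'⟩
  · intro u hu
    have h0 := (hg u _).1 (Part.get_mem hu)
    -- Some output on `u` is known to be valid; uniqueness identifies it with the given one.
    obtain ⟨v', h1, h2⟩ := hmem u (hdom _ _ h0)
    have h3 := (mem_transduction_iff_relPath hT).2 h2
    rwa [← huniq _ _ _ h0 h1] at h3
  -- Two tokens and a direction give `2 * (2 * 2 ^ n) ^ 2` and `2 * (2 * n) ^ 2` states, hence the
  -- factor 64.
  · simp only [Fintype.card_prod, Fintype.card_fin, Fintype.card_bool]
    rw [pow_mul', sq (2 ^ n)]
    calc _ = 64 * (n ^ 2 * (2 ^ n * 2 ^ n)) := by ring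
      _ ≤ 144 * (n ^ 2 * (2 ^ n * 2 ^ n)) := Nat.mul_le_mul_right _ (by norm_num)
      _ = _ := by ring
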